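/- \textbf{Setting.} Let $G=(V,E,K,m)$ be a graph with finite or countable node set $V$, undirected edges $\langle x,y\rangle\in E$, no loops and no multiple edges; write $y\sim x$ if $\langle x,y\rangle\in E$. Here $K=(k_{xy})$ with $k_{xy}=k_{yx}\ge 0$ and $k_{xy}=0$ if $y\not\sim x$, and $m_x>0$ for $x\in V$. The nodes are distinct points of a real Hilbert space $H$, and $e_{xy}=(y-x)/|y-x|$. Assume that $\sup_x \#\{y:y\sim x\}$, $\sup_x m_x^{-1}$ and $\sup_{\langle x,y\rangle\in E}k_{xy}$ are finite. Let $V=V_0\cup V_1$ with $V_0\cap V_1=\varnothing$. $F(G)$ is the set of all $f$ that assign a real number $f(x)$ to every node $x$ and a vector $f(\langle x,y\rangle)\in\mathbb{R}(y-x)\subset H$ to every edge. $F_0(G)$ is the set of those $f\in F(G)$ that vanish outside a finite subset of $V\cup E$ and satisfy $|f(x)|\in\mathbb{Z}$ for all $x\in V$ and $|f(\langle x,y\rangle)|\in\mathbb{Z}$ for all $\langle x,y\rangle\in E$. Let $\delta_{xy}\in F_0(G)$ be $e_{xy}$ on the edge $\langle x,y\rangle$ and $0$ elsewhere, and let $\hat\delta_x\in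 F_0(G)$ be $1$ at the node $x$ if $x\in V_0$, and $0$ elsewhere (so $\hat\delta_x=0$ if $x\in V_1$). The interacting particle system $\{f_t:t\ge 0\}$ is the continuous-time Markov jump process on the countable set $F_0(G)$ (given by its embedded jump chain and exponential holding times) with generator $$\mathcal{A}\Phi(f)=\sum_{x\in V}\frac{|f(x)|}{m_x}\Big\{\Phi\Big(f+\operatorname{sgn}(f(x))\sum_{y\sim x}\delta_{yx}\Big)-\Phi(f)\Big\}+\sum_{\langle x,y\rangle\in E}k_{xy}|f(\langle x,y\rangle)|\Big\{\Phi\Big(f+\operatorname{sgn}(f(\langle x,y\rangle)\cdot e_{xy})(\hat\delta_x-\hat\delta_y)\Big)-\Phi(f)\Big\}$$ for $\Phi:F_0(G)\to\mathbb{R}$, and $\mathbb{E}_f$ is the expectation when $f_0=f$. \textbf{Theorem (Feynman--Kac-type formula).} Let $\varphi,\psi:V\to\mathbb{R}$ with $\psi|_{V_1}=0$, and define $f\in F(G)$ by $$f(x)=m_x\psi(x)\ \ (x\in V),\qquad f(\langle x,y\rangle)=[\varphi(y)-\varphi(x)]\,e_{xy}\ \ (\langle x,y\rangle\in E).$$ Suppose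 $f\in F_0(G)$, and let $\{f_t:t\ge 0\}$ be the interacting particle system started from $f$. Then for all $x\in V$ and $t\ge 0$ the integral $\int_0^t f_s(x)\,ds$ exists almost surely and is an integrable random variable, and $$u(x,t)=\varphi(x)+\frac{1}{m_x}\,\mathbb{E}_f\Big(\int_0^t f_s(x)\,ds\Big)$$ solves the Dirichlet initial--boundary value problem for the wave equation on $G$: $$\begin{cases} m_x\dfrac{d^2u}{dt^2}(x,t)=\sum_{y\in V}k_{xy}\,[u(y,t)-u(x,t)], & (x,t)\in V_0\times[0,\infty),\\[1ex] u(x,0)=\varphi(x),\quad \dfrac{du}{dt}(x,0)=\psi(x), & x\in V,\\[1ex] u(x,t)=\varphi(x), & (x,t)\in V_1\times[0,\infty),\end{cases}$$ where time derivatives at $t=0$ are one-sided. -/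

import Mathlib

open MeasureTheory Set
open scoped ENNReal NNReal ProbabilityTheory

noncomputable section

/-! ## Continuous-time Markov chains on a countable state space, given by their generator

For a countable set `S` and an operator `L` on functions `S → ℝ` of the form
`L φ a = ∑ b, q a b * (φ b - φ a)`, the off-diagonal rates are `q a b = L 1_{b} a` and the total
rate of leaving `a` is `- L 1_{a} a`. -/

section JumpProcess

variable {S : Type*} {Ω : Type*}

/-- The rate of the transition `a → b` (for `b ≠ a`) of the chain with generator `L`. -/
def jumpRate (L : (S → ℝ) → (S → ℝ)) (a b : S) : ℝ :=
  L (Set.indicator {b} (fun _ => (1 : ℝ))) a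

/-- The total rate at which the chain with generator `L` leaves the state `a`. -/
def exitRate (L : (S → ℝ) → (S → ℝ)) (a : S) : ℝ :=
  - L (Set.indicator {a} (fun _ => (1 : ℝ))) a

open Classical in
/-- The transition probabilities of the skeleton (embedded jump chain). A state with total rate
zero is absorbing. -/
def jumpProb (L : (S → ℝ) → (S → ℝ)) (a b : S) : ℝ :=
  if exitRate L a = 0 then (if b = a then 1 else 0)
  else (if b = a then 0 else jumpRate L a b / exitRate L a)

/-- The information in the first `n + 1` states `h 0, …, h n` of the skeleton and in the holding
times `ξ 0, …, ξ (n - 1)` in the first `n` of them. -/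
abbrev jumpHistory [MeasurableSpace S] (h : ℕ → Ω → S) (ξ : ℕ → Ω → ℝ≥0∞) (n : ℕ) :
    MeasurableSpace Ω :=
  (⨆ i ∈ Finset.range (n + 1), MeasurableSpace.comap (h i) inferInstance) ⊔
    ⨆ i ∈ Finset.range n, MeasurableSpace.comap (ξ i) inferInstance

/-- `h` and `ξ` are the skeleton and the holding times of the chain with generator `L` started at
`a`: given the history up to the arrival in `h n`, the holding time `ξ n` in the state `h n` and
the next state `h (n + 1)` are independent, the former is exponential with rate
`exitRate L (h n)` (infinite if that rate is zero), and the latter has law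
`jumpProb L (h n) ·`. -/
structure IsJumpChain [MeasurableSpace S] [MeasurableSpace Ω] (L : (S → ℝ) → (S → ℝ)) (a : S)
    (P : Measure Ω) (h : ℕ → Ω → S) (ξ : ℕ → Ω → ℝ≥0∞) : Prop where
  measurable_state : ∀ n, Measurable (h n)
  measurable_hold : ∀ n, Measurable (ξ n)
  start : ∀ᵐ ω ∂P, h 0 ω = a
  step : ∀ (n : ℕ) (b : S) (s : ℝ≥0),
    P⟦{ω | (s : ℝ≥0∞) < ξ n ω ∧ h (n + 1) ω = b} | jumpHistory h ξ n⟧ =ᵐ[P]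
      fun ω => Real.exp (-(exitRate L (h n ω)) * s) * jumpProb L (h n ω) b

/-- `X` is a continuous-time Markov chain with generator `L` started at `a`: almost surely it sits
in the state `h n` of the skeleton during `[τ n, τ (n + 1))`, where `τ n = ξ 0 + ⋯ + ξ (n - 1)` is
the time of the `n`-th jump. Nothing is required of `X` from time `sup τ n` on, and nothing is
assumed about that time being infinite. -/
def IsMarkovJumpProcess [MeasurableSpace S] [MeasurableSpace Ω] (L : (S → ℝ) → (S → ℝ)) (a : S)
    (P : Measure Ω) (X : ℝ≥0 → Ω → S) : Prop :=
  ∃ (h : ℕ → Ω → S) (ξ : ℕ → Ω → ℝ≥0∞), IsJumpChain L a P h ξ ∧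
    ∀ᵐ ω ∂P, ∀ (n : ℕ) (t : ℝ≥0),
      ∑ i ∈ Finset.range n, ξ i ω ≤ t → (t : ℝ≥0∞) < ∑ i ∈ Finset.range (n + 1), ξ i ω →
        X t ω = h n ω

end JumpProcess

/-! ## Weighted graphs embedded in a Hilbert space -/

/-- A weighted graph `(V, E, K, m)` whose nodes are points of the space `H`, with bounded degrees,
and with the inverse masses and the edge weights bounded above. -/
structure WaveGraph (V H : Type*) [NormedAddCommGroup H] where
  graph : SimpleGraph V
  pos : V ↪ H
  k : V → V → ℝ
  m : V → ℝ
  k_symm : ∀ x y, k x y = k y x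
  k_nonneg : ∀ x y, 0 ≤ k x y
  k_eq_zero : ∀ x y, ¬ graph.Adj x y → k x y = 0
  m_pos : ∀ x, 0 < m x
  degree_bdd : ∃ D : ℕ, ∀ x, (graph.neighborSet x).encard ≤ D
  inv_m_bdd : ∃ M : ℝ, ∀ x, (m x)⁻¹ ≤ M
  k_bdd : ∃ M : ℝ, ∀ x y, graph.Adj x y → k x y ≤ M

namespace WaveGraph

variable {V H : Type*} [NormedAddCommGroup H]

theorem finite_neighborSet (G : WaveGraph V H) (x : V) : (G.graph.neighborSet x).Finite := by
  obtain ⟨D, hD⟩ := G.degree_bdd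
  exact Set.finite_of_encard_le_coe (hD x)

/-- The neighbours of a node. -/
def nbrs (G : WaveGraph V H) (x : V) : Finset V := (G.finite_neighborSet x).toFinset

/-- The weight of an edge. -/
def kEdge (G : WaveGraph V H) (e : G.graph.edgeSet) : ℝ :=
  Sym2.lift ⟨fun x y => G.k x y, G.k_symm⟩ e.1

variable [InnerProductSpace ℝ H]

/-- The unit vector `e_{xy}` pointing from `x` to `y`. -/
def unit (G : WaveGraph V H) (x y : V) : H := ‖G.pos y - G.pos x‖⁻¹ • (G.pos y - G.pos x)

theorem unit_swap (G : WaveGraph V H) (x y : V) : G.unit y x = - G.unit x y := by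
  unfold unit
  rw [norm_sub_rev, ← smul_neg, neg_sub]

theorem norm_unit (G : WaveGraph V H) {x y : V} (h : x ≠ y) : ‖G.unit x y‖ = 1 := by
  unfold unit
  have : ‖G.pos y - G.pos x‖ ≠ 0 := by
    rw [norm_ne_zero_iff, sub_ne_zero]
    exact fun e => h (G.pos.injective e).symm
  rw [norm_smul, norm_inv, norm_norm, inv_mul_cancel₀ this]

/-- `F(G)`: pairs of a scalar field on the nodes and a vector field on the edges, the latter
having at every edge a value parallel to that edge. -/
def field (G : WaveGraph V H) : Set ((V → ℝ) × (G.graph.edgeSet → H)) :=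
  {f | ∀ (x y : V) (hxy : G.graph.Adj x y), ∃ c : ℝ,
    f.2 ⟨s(x, y), hxy⟩ = c • (G.pos y - G.pos x)}

/-- The condition that defines `F₀(G)`: finite support, and integer absolute values. -/
def IsConfig (G : WaveGraph V H) (f : (V → ℝ) × (G.graph.edgeSet → H)) : Prop :=
  f ∈ G.field ∧ {x | f.1 x ≠ 0}.Finite ∧ {e | f.2 e ≠ 0}.Finite ∧
    (∀ x, ∃ n : ℤ, |f.1 x| = n) ∧ ∀ e, ∃ n : ℤ, ‖f.2 e‖ = n

theorem exists_int_of_abs {r : ℝ} (h : ∃ n : ℤ, |r| = n) : ∃ n : ℤ, r = n := by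
  obtain ⟨n, hn⟩ := h
  rcases abs_choice r with h | h
  · exact ⟨n, by rw [← hn, h]⟩
  · exact ⟨-n, by push_cast; rw [← hn, h, neg_neg]⟩

theorem exists_abs_int {r : ℝ} (h : ∃ n : ℤ, r = n) : ∃ n : ℤ, |r| = n := by
  obtain ⟨n, hn⟩ := h
  exact ⟨|n|, by rw [hn]; push_cast; rfl⟩

theorem exists_int_smul_unit (G : WaveGraph V H) {f : (V → ℝ) × (G.graph.edgeSet → H)}
    (hf : f ∈ G.field) {x y : V} (hxy : G.graph.Adj x y)
    (hn : ∃ n : ℤ, ‖f.2 ⟨s(x, y), hxy⟩‖ = n) :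
    ∃ n : ℤ, f.2 ⟨s(x, y), hxy⟩ = (n : ℝ) • G.unit x y := by
  obtain ⟨c, hc⟩ := hf x y hxy
  have hne : ‖G.pos y - G.pos x‖ ≠ 0 := by
    rw [norm_ne_zero_iff, sub_ne_zero]
    exact fun e => hxy.ne (G.pos.injective e).symm
  have hc' : f.2 ⟨s(x, y), hxy⟩ = (c * ‖G.pos y - G.pos x‖) • G.unit x y := by
    rw [hc, unit, smul_smul, mul_assoc, mul_inv_cancel₀ hne, mul_one]
  rw [hc', norm_smul, G.norm_unit hxy.ne, mul_one, Real.norm_eq_abs] at hn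
  obtain ⟨n, hn⟩ := exists_int_of_abs hn
  exact ⟨n, by rw [hc', hn]⟩

/-- `F₀(G)`, the state space of the particle system, as a group under pointwise addition. -/
def config (G : WaveGraph V H) : AddSubgroup ((V → ℝ) × (G.graph.edgeSet → H)) where
  carrier := {f | G.IsConfig f}
  zero_mem' := by
    refine ⟨fun x y _ => ⟨0, by simp⟩, by simp, by simp, fun x => ⟨0, by simp⟩,
      fun e => ⟨0, by simp⟩⟩
  add_mem' := by
    rintro f g ⟨hf, hfV, hfE, hfn, hfe⟩ ⟨hg, hgV, hgE, hgn, hge⟩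
    refine ⟨?_, ?_, ?_, ?_, ?_⟩
    · intro x y hxy
      obtain ⟨c, hc⟩ := hf x y hxy
      obtain ⟨d, hd⟩ := hg x y hxy
      exact ⟨c + d, by simp [hc, hd, add_smul]⟩
    · refine (hfV.union hgV).subset fun x hx => ?_
      by_contra hcon
      simp only [Set.mem_union, Set.mem_ofPred_eq, not_or, not_not] at hcon
      exact hx (by simp [hcon.1, hcon.2])
    · refine (hfE.union hgE).subset fun x hx => ?_
      by_contra hcon
      simp only [Set.mem_union, Set.mem_ofPred_eq, not_or, not_not] at hcon
      exact hx (by simp [hcon.1, hcon.2])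
    · intro x
      obtain ⟨a, ha⟩ := exists_int_of_abs (hfn x)
      obtain ⟨b, hb⟩ := exists_int_of_abs (hgn x)
      exact exists_abs_int ⟨a + b, by simp [ha, hb]⟩
    · rintro ⟨e, he⟩
      induction e using Sym2.ind with
      | _ x y =>
        obtain ⟨a, ha⟩ := G.exists_int_smul_unit hf he (hfe _)
        obtain ⟨b, hb⟩ := G.exists_int_smul_unit hg he (hge _)
        refine ⟨|a + b|, ?_⟩
        rw [Prod.snd_add, Pi.add_apply, ha, hb, ← add_smul, norm_smul,
          G.norm_unit (SimpleGraph.Adj.ne he), mul_one, Real.norm_eq_abs]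
        push_cast
        rfl
  neg_mem' := by
    rintro f ⟨hf, hfV, hfE, hfn, hfe⟩
    refine ⟨?_, by simpa using hfV, by simpa using hfE, by simpa using hfn, by simpa using hfe⟩
    intro x y hxy
    obtain ⟨c, hc⟩ := hf x y hxy
    exact ⟨-c, by simp [hc]⟩

instance (G : WaveGraph V H) : MeasurableSpace G.config := ⊤

open Classical in
/-- `δ_{xy}`: the unit vector `e_{xy}` on the edge `⟨x, y⟩`, zero elsewhere. -/
def deltaEdge (G : WaveGraph V H) (x y : V) : G.config :=
  ⟨(0, fun e => if e.1 = s(x, y) then G.unit x y else 0), by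
    refine ⟨?_, by simp, ?_, fun x => ⟨0, by simp⟩, ?_⟩
    · intro a b hab
      by_cases h : s(a, b) = s(x, y)
      · rcases Sym2.eq_iff.mp h with ⟨rfl, rfl⟩ | ⟨rfl, rfl⟩
        · exact ⟨‖G.pos b - G.pos a‖⁻¹, by simp [unit]⟩
        · refine ⟨-‖G.pos b - G.pos a‖⁻¹, ?_⟩
          simp only [h, if_true]
          rw [G.unit_swap a b, unit, neg_smul]
      · exact ⟨0, by simp only [h, if_false, zero_smul]⟩
    · have : {e : G.graph.edgeSet | e.1 = s(x, y)}.Subsingleton :=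
        fun a ha b hb => Subtype.ext (ha.trans hb.symm)
      refine this.finite.subset fun e he => ?_
      by_contra h
      exact he (if_neg h)
    · intro e
      by_cases h : e.1 = s(x, y)
      · have he : G.graph.Adj x y := by
          have := e.2
          rwa [h] at this
        exact ⟨1, by simp [h, G.norm_unit he.ne]⟩
      · exact ⟨0, by simp [h]⟩⟩

open Classical in
/-- `\hat δ_x`: one at the node `x` if `x ∈ V₀`, zero elsewhere. -/
def deltaHat (G : WaveGraph V H) (V₀ : Set V) (x : V) : G.config :=
  ⟨(fun z => if z = x ∧ x ∈ V₀ then 1 else 0, 0), by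
    refine ⟨fun a b hab => ⟨0, by simp⟩, ?_, by simp, ?_, fun e => ⟨0, by simp⟩⟩
    · refine (Set.finite_singleton x).subset fun z hz => ?_
      by_contra h
      exact hz (if_neg fun h' => h h'.1)
    · intro z
      by_cases h : z = x ∧ x ∈ V₀
      · exact ⟨1, by simp [h]⟩
      · exact ⟨0, by simp [h]⟩⟩

/-- The state after a particle at the node `x` has acted:
`f + sgn (f x) ∑_{y ∼ x} δ_{yx}`. -/
def nodeMove (G : WaveGraph V H) (f : G.config) (x : V) : G.config :=
  f + (SignType.sign (f.1.1 x) : ℤ) • ∑ y ∈ G.nbrs x, G.deltaEdge y x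

/-- The state after a particle at the edge `e = ⟨x, y⟩` has acted:
`f + sgn (f e ⬝ e_{xy}) (\hat δ_x - \hat δ_y)`. -/
def edgeMove (G : WaveGraph V H) (V₀ : Set V) (f : G.config) (e : G.graph.edgeSet) : G.config :=
  f + Sym2.lift
    ⟨fun x y => (SignType.sign (inner ℝ (f.1.2 e) (G.unit x y)) : ℤ) •
        (G.deltaHat V₀ x - G.deltaHat V₀ y), by
      intro x y
      beta_reduce
      rw [G.unit_swap x y, inner_neg_right, Left.sign_neg, SignType.coe_neg, neg_smul,
        ← smul_neg, neg_sub]⟩ e.1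

/-- The generator of the interacting particle system. Both sums have finitely many nonzero
terms. -/
def generator (G : WaveGraph V H) (V₀ : Set V) (φ : G.config → ℝ) (f : G.config) : ℝ :=
  (∑' x : V, |f.1.1 x| / G.m x * (φ (G.nodeMove f x) - φ f)) +
    ∑' e : G.graph.edgeSet, G.kEdge e * ‖f.1.2 e‖ * (φ (G.edgeMove V₀ f e) - φ f)

/-- `X` is the interacting particle system on `G` (with interior `V₀`) started from `f`. -/
def IsIPS {Ω : Type*} [MeasurableSpace Ω] (G : WaveGraph V H) (V₀ : Set V) (f : G.config)
    (P : Measure Ω) (X : ℝ≥0 → Ω → G.config) : Prop :=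
  IsMarkovJumpProcess (G.generator V₀) f P X

/-- The field with values `m_x ψ(x)` on the nodes and `[φ(y) - φ(x)] e_{xy}` on the edges. -/
def initialField (G : WaveGraph V H) (φ ψ : V → ℝ) : (V → ℝ) × (G.graph.edgeSet → H) :=
  (fun x => G.m x * ψ x, fun e => Sym2.lift
    ⟨fun x y => (φ y - φ x) • G.unit x y, by
      intro x y
      beta_reduce
      rw [G.unit_swap x y, smul_neg, ← neg_smul, neg_sub]⟩ e.1)

/-- `u` (looked at on `V × [0, ∞)` only) solves the Dirichlet initial-boundary value problem for
the wave equation on `G`. Derivatives in time are one-sided at `t = 0`. -/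
structure SolvesDirichlet (G : WaveGraph V H) (V₀ V₁ : Set V) (φ ψ : V → ℝ)
    (u : V → ℝ → ℝ) : Prop where
  wave : ∀ x ∈ V₀, ∃ v : ℝ → ℝ, (∀ t, 0 ≤ t → HasDerivWithinAt (u x) (v t) (Ici 0) t) ∧
    ∀ t, 0 ≤ t → ∃ a : ℝ, HasDerivWithinAt v a (Ici 0) t ∧
      HasSum (fun y => G.k x y * (u y t - u x t)) (G.m x * a)
  initial_value : ∀ x, u x 0 = φ x
  initial_velocity : ∀ x, HasDerivWithinAt (u x) (ψ x) (Ici 0) 0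
  boundary : ∀ x ∈ V₁, ∀ t, 0 ≤ t → u x t = φ x

end WaveGraph

end

/-! The signs in the moves cancel the absolute values in the rates (`abs_mul_sign_intCast`), so the
generator maps linear coordinates of a configuration to linear coordinates. The component along
e_{xy} of the edge value goes to f(y)/m_y - f(x)/m_x (`generator_edgeVal`). The value at a node x of
V₀ goes to the sum over y of k_{xy} times these edge components (`generator_nodeVal`), and the value
at any other node goes to 0. Let N(x,t) be the mean of f_t(x), so that u = φ + m⁻¹∫N. Dynkin's
formula on an edge, whose initial component is φ(y) - φ(x), shows that the mean edge component is
u(y,t) - u(x,t). Dynkin's formula at a node of V₀ then says that N = m u' has derivative ∑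
k_{xy}(u(y,t) - u(x,t)), which is the wave equation.

The work lies in Dynkin's formula for unbounded functions of a chain that is not assumed to be
non-explosive. By the exponential holding times, the expected number of transitions c → b at a given
jump number is the rate times the expected time spent in c at that stage (`measure_transition`).
Summation over states and jump numbers gives a forward equation in [0,∞], with losses and gains on
opposite sides so that nothing is subtracted (`balance`).

Let ρ be 1 plus the ℓ¹ norm. The total rate is at most Kρ and a jump raises ρ by at most D, so ρ² is
a Lyapunov function (`lyapunov_sq`) whose mean over non-exploded paths grows at most exponentially
(`lyapunov`). Hence the mean exit rate is integrable in time, the forward equation for the constant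
1 rules out explosion (`nonexplosion`), and the forward equations for the positive and negative
parts of a function of size at most ρ have finite terms and can be subtracted (`dynkin`). -/

noncomputable section

/-! ### The law of a single transition -/

section AbstractChain

variable {S Ω : Type*}

/-- The generator `L` has nonnegative exit rates and its skeleton has honest transition
probabilities. -/
structure IsRateOperator (L : (S → ℝ) → (S → ℝ)) : Prop where
  exitRate_nonneg : ∀ c, 0 ≤ exitRate L c
  jumpProb_nonneg : ∀ c b, 0 ≤ jumpProb L c b
  tsum_jumpProb : ∀ c, ∑' b, ENNReal.ofReal (jumpProb L c b) = 1

/-- The time of the `n`-th jump. -/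
def jumpTime (ξ : ℕ → Ω → ℝ≥0∞) (n : ℕ) (ω : Ω) : ℝ≥0∞ := ∑ i ∈ Finset.range n, ξ i ω

/-- The event that exactly `n` jumps have occurred at time `s`. -/
def jumpSlot (ξ : ℕ → Ω → ℝ≥0∞) (n : ℕ) (s : ℝ) : Set Ω :=
  {ω | jumpTime ξ n ω ≤ ENNReal.ofReal s ∧ ENNReal.ofReal s < jumpTime ξ (n + 1) ω}

/-- The off-diagonal rates as elements of `[0, ∞]`. -/
def eRate (L : (S → ℝ) → (S → ℝ)) (c b : S) : ℝ≥0∞ :=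
  ENNReal.ofReal (exitRate L c) * ENNReal.ofReal (jumpProb L c b)

theorem jumpTime_succ (ξ : ℕ → Ω → ℝ≥0∞) (n : ℕ) (ω : Ω) :
    jumpTime ξ (n + 1) ω = jumpTime ξ n ω + ξ n ω := Finset.sum_range_succ _ _

theorem IsRateOperator.tsum_eRate {L : (S → ℝ) → (S → ℝ)} (hL : IsRateOperator L) (c : S) :
    ∑' b, eRate L c b = ENNReal.ofReal (exitRate L c) := by
  simp only [eRate, ENNReal.tsum_mul_left, hL.tsum_jumpProb, mul_one]

/-- Dynkin's formula for the single jump of an exponential clock started at time `y`. -/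
theorem exponential_clock {q : ℝ} (hq : 0 ≤ q) {ν : Measure ℝ≥0∞} [IsProbabilityMeasure ν]
    (hν : ∀ s : ℝ≥0, ν (Ioi (s : ℝ≥0∞)) = ENNReal.ofReal (Real.exp (-q * s)))
    (y : ℝ≥0∞) {t : ℝ} (ht : 0 ≤ t) :
    ν {z | y + z ≤ ENNReal.ofReal t} = ENNReal.ofReal q *
      ∫⁻ s in Ioc 0 t, ν {z | y ≤ ENNReal.ofReal s ∧ ENNReal.ofReal s < y + z} := by
  rcases lt_or_ge (ENNReal.ofReal t) y with hy | hy
  · have h1 : {z | y + z ≤ ENNReal.ofReal t} = ∅ := by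
      ext z
      simp only [mem_ofPred_eq, mem_empty_iff_false, iff_false, not_le]
      exact hy.trans_le le_self_add
    rw [h1, measure_empty, setLIntegral_congr_fun (g := fun _ => 0) measurableSet_Ioc]
    · simp
    · intro s hs
      have : {z | y ≤ ENNReal.ofReal s ∧ ENNReal.ofReal s < y + z} = ∅ := by
        ext z
        simp only [mem_ofPred_eq, mem_empty_iff_false, iff_false, not_and]
        intro h
        exact absurd (h.trans (ENNReal.ofReal_le_ofReal hs.2)) (not_le.2 hy)
      simp [this]
  · lift y to ℝ≥0 using ne_top_of_le_ne_top ENNReal.ofReal_ne_top hy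
    have hyt : (y : ℝ) ≤ t := by
      have := ENNReal.toReal_mono ENNReal.ofReal_ne_top hy
      rwa [ENNReal.toReal_ofReal ht] at this
    have key : ∀ s : ℝ, (y : ℝ) ≤ s → {z : ℝ≥0∞ | ENNReal.ofReal s < y + z} =
        Ioi (((s - y).toNNReal : ℝ≥0) : ℝ≥0∞) := by
      intro s hs
      ext z
      have h0 : ENNReal.ofReal s = y + ((s - y).toNNReal : ℝ≥0) := by
        rw [← ENNReal.coe_add, ENNReal.ofReal]
        congr 1
        apply NNReal.coe_injective
        simp [hs, y.2.trans hs]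
      simp only [mem_ofPred_eq, mem_Ioi, h0]
      exact ENNReal.add_lt_add_iff_left ENNReal.coe_ne_top
    have hν' : ∀ s : ℝ, (y : ℝ) ≤ s → ν {z : ℝ≥0∞ | ENNReal.ofReal s < y + z} =
        ENNReal.ofReal (Real.exp (-q * (s - y))) := by
      intro s hs
      rw [key s hs, hν, Real.coe_toNNReal _ (sub_nonneg.2 hs)]
    have hL : ν {z | (y : ℝ≥0∞) + z ≤ ENNReal.ofReal t} =
        ENNReal.ofReal (1 - Real.exp (-q * (t - y))) := by
      have h1 : {z | (y : ℝ≥0∞) + z ≤ ENNReal.ofReal t} =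
          {z : ℝ≥0∞ | ENNReal.ofReal t < y + z}ᶜ := by
        ext z; simp
      rw [h1, measure_compl (by rw [key t hyt]; exact measurableSet_Ioi) (measure_ne_top _ _),
        hν' t hyt, measure_univ, ENNReal.ofReal_sub _ (Real.exp_pos _).le, ENNReal.ofReal_one]
    have hR : ∫⁻ s in Ioc 0 t, ν {z | (y : ℝ≥0∞) ≤ ENNReal.ofReal s ∧ ENNReal.ofReal s < y + z} =
        ∫⁻ s in Ioc (y : ℝ) t, ENNReal.ofReal (Real.exp (-q * (s - y))) := by
      -- The two integrands may differ at s = y, where the clock has started but the half-open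
      -- interval has not; this is a null set.
      have : ∀ᵐ s : ℝ, s ≠ (y : ℝ) := Measure.ae_ne volume (y : ℝ)
      rw [← lintegral_indicator measurableSet_Ioc, ← lintegral_indicator measurableSet_Ioc]
      refine lintegral_congr_ae ?_
      filter_upwards [this] with s hs
      by_cases h : s ∈ Ioc (y : ℝ) t
      · have h' : s ∈ Ioc 0 t := ⟨y.2.trans_lt h.1, h.2⟩
        rw [indicator_of_mem h, indicator_of_mem h', ← hν' s h.1.le]
        congr 1
        ext z
        simp only [mem_ofPred_eq, and_iff_right_iff_imp]
        intro _
        rw [← ENNReal.ofReal_coe_nnreal]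
        exact ENNReal.ofReal_le_ofReal h.1.le
      · rw [indicator_of_notMem h]
        by_cases h' : s ∈ Ioc 0 t
        · rw [indicator_of_mem h']
          have hlt : s < y := lt_of_le_of_ne (not_lt.1 fun h2 => h ⟨h2, h'.2⟩) hs
          convert measure_empty (μ := ν)
          ext z
          simp only [mem_ofPred_eq, mem_empty_iff_false, iff_false, not_and]
          intro h2
          rw [← ENNReal.ofReal_coe_nnreal, ENNReal.ofReal_le_ofReal_iff h'.1.le] at h2
          exact absurd h2 (not_le.2 hlt)
        · rw [indicator_of_notMem h']
    rw [hL, hR, ← lintegral_const_mul' _ _ ENNReal.ofReal_ne_top]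
    simp only [← ENNReal.ofReal_mul hq]
    have hc : Continuous fun s : ℝ => q * Real.exp (-q * (s - y)) := by fun_prop
    rw [← ofReal_integral_eq_lintegral_ofReal]
    · congr 1
      rw [← intervalIntegral.integral_of_le hyt,
        intervalIntegral.integral_eq_sub_of_hasDerivAt (f := fun s => -Real.exp (-q * (s - y)))]
      · simp; ring
      · intro s _
        have h1 : HasDerivAt (fun s : ℝ => -q * (s - y)) (-q) s := by
          simpa using ((hasDerivAt_id s).sub_const (y : ℝ)).const_mul (-q)
        exact h1.exp.neg.congr_deriv (by ring)
      · exact hc.intervalIntegrable _ _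
    · exact (hc.integrableOn_Icc).mono_set Ioc_subset_Icc_self
    · exact Filter.Eventually.of_forall fun s => mul_nonneg hq (Real.exp_pos _).le

variable [MeasurableSpace S] {h : ℕ → Ω → S} {ξ : ℕ → Ω → ℝ≥0∞}

theorem measurable_jumpTime_history (n : ℕ) : Measurable[jumpHistory h ξ n] (jumpTime ξ n) := by
  refine Finset.measurable_fun_sum _ fun i hi => ?_
  refine Measurable.mono (comap_measurable (ξ i)) ?_ le_rfl
  exact le_sup_of_le_right (le_iSup₂_of_le i hi le_rfl)

theorem measurable_state_history (n : ℕ) : Measurable[jumpHistory h ξ n] (h n) := by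
  refine Measurable.mono (comap_measurable (h n)) ?_ le_rfl
  exact le_sup_of_le_left (le_iSup₂_of_le n (Finset.self_mem_range_succ n) le_rfl)

theorem measurableSet_state [MeasurableSingletonClass S] (n : ℕ) (c : S) :
    MeasurableSet[jumpHistory h ξ n] {ω | h n ω = c} :=
  measurable_state_history n (measurableSet_singleton c)

variable [MeasurableSpace Ω] {L : (S → ℝ) → (S → ℝ)} {a : S} {P : Measure Ω}

namespace IsJumpChain

theorem jumpHistory_le (hc : IsJumpChain L a P h ξ) (n : ℕ) :
    jumpHistory h ξ n ≤ (inferInstance : MeasurableSpace Ω) := by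
  refine sup_le (iSup₂_le fun i _ => (hc.measurable_state i).comap_le)
    (iSup₂_le fun i _ => (hc.measurable_hold i).comap_le)

theorem measurable_jumpTime (hc : IsJumpChain L a P h ξ) (n : ℕ) : Measurable (jumpTime ξ n) :=
  Finset.measurable_fun_sum _ fun i _ => hc.measurable_hold i

theorem measurableSet_jumpSlot (hc : IsJumpChain L a P h ξ) (n : ℕ) (s : ℝ) :
    MeasurableSet (jumpSlot ξ n s) :=
  (measurableSet_le (hc.measurable_jumpTime n) measurable_const).inter
    (measurableSet_lt measurable_const (hc.measurable_jumpTime (n + 1)))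

theorem measurableSet_jumpSlot_prod (hc : IsJumpChain L a P h ξ) (n : ℕ) :
    MeasurableSet {x : ℝ × Ω | x.2 ∈ jumpSlot ξ n x.1} :=
  (measurableSet_le ((hc.measurable_jumpTime n).comp measurable_snd)
      (ENNReal.measurable_ofReal.comp measurable_fst)).inter
    (measurableSet_lt (ENNReal.measurable_ofReal.comp measurable_fst)
      ((hc.measurable_jumpTime (n + 1)).comp measurable_snd))

variable [IsProbabilityMeasure P] [MeasurableSingletonClass S]

/-- On a history event inside {h n = c} the conditional probability is constant, so integrating it
over the event gives a product. -/
theorem measure_step (hc : IsJumpChain L a P h ξ) {n : ℕ} {c : S}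
    {B : Set Ω} (hB : MeasurableSet[jumpHistory h ξ n] B) (hBc : ∀ ω ∈ B, h n ω = c) (b : S)
    (s : ℝ≥0) :
    P (B ∩ {ω | h (n + 1) ω = b} ∩ {ω | (s : ℝ≥0∞) < ξ n ω}) =
      ENNReal.ofReal (Real.exp (-exitRate L c * s)) * ENNReal.ofReal (jumpProb L c b) * P B := by
  have hA : MeasurableSet {ω | (s : ℝ≥0∞) < ξ n ω ∧ h (n + 1) ω = b} :=
    (measurableSet_lt measurable_const (hc.measurable_hold n)).inter
      (hc.measurable_state (n + 1) (measurableSet_singleton b))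
  have hB' := hc.jumpHistory_le n B hB
  have h1 := setIntegral_condExp (μ := P) (hc.jumpHistory_le n)
    ((integrable_const (1 : ℝ)).indicator hA) hB
  rw [setIntegral_congr_ae (g := fun _ => Real.exp (-exitRate L c * s) * jumpProb L c b) hB',
    setIntegral_indicator hA] at h1
  · simp only [setIntegral_const, smul_eq_mul, mul_one] at h1
    have h2 : B ∩ {ω | h (n + 1) ω = b} ∩ {ω | (s : ℝ≥0∞) < ξ n ω} =
        B ∩ {ω | (s : ℝ≥0∞) < ξ n ω ∧ h (n + 1) ω = b} := by
      ext ω; simp only [mem_inter_iff, mem_ofPred_eq]; tauto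
    rw [h2, ← ofReal_measureReal, ← h1, ENNReal.ofReal_mul measureReal_nonneg,
      ofReal_measureReal, ENNReal.ofReal_mul (Real.exp_pos _).le, mul_comm]
  · filter_upwards [hc.step n b s] with ω hω hωB
    exact hω.trans (by rw [hBc ω hωB])

variable [Countable S]

theorem measure_hold (hc : IsJumpChain L a P h ξ) (hL : IsRateOperator L) {n : ℕ} {c : S}
    {B : Set Ω} (hB : MeasurableSet[jumpHistory h ξ n] B) (hBc : ∀ ω ∈ B, h n ω = c) (s : ℝ≥0) :
    P (B ∩ {ω | (s : ℝ≥0∞) < ξ n ω}) =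
      ENNReal.ofReal (Real.exp (-exitRate L c * s)) * P B := by
  have h1 : B ∩ {ω | (s : ℝ≥0∞) < ξ n ω} =
      ⋃ b, (B ∩ {ω | h (n + 1) ω = b} ∩ {ω | (s : ℝ≥0∞) < ξ n ω}) := by
    ext ω; simp
  have hB' := hc.jumpHistory_le n B hB
  rw [h1, measure_iUnion]
  · simp only [hc.measure_step hB hBc]
    rw [ENNReal.tsum_mul_right, ENNReal.tsum_mul_left, hL.tsum_jumpProb, mul_one]
  · intro b b' hbb
    refine Set.disjoint_left.2 fun ω h1 h2 => hbb ?_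
    exact h1.1.2.symm.trans h2.1.2
  · intro b
    exact (hB'.inter (hc.measurable_state (n + 1) (measurableSet_singleton b))).inter
      (measurableSet_lt measurable_const (hc.measurable_hold n))

theorem hold_pos (hc : IsJumpChain L a P h ξ) (hL : IsRateOperator L) (n : ℕ) :
    ∀ᵐ ω ∂P, 0 < ξ n ω := by
  have h1 : ∀ c : S, ∀ᵐ ω ∂P, h n ω = c → 0 < ξ n ω := by
    intro c
    have h2 := hc.measure_hold hL (measurableSet_state (h := h) (ξ := ξ) n c) (fun _ hω => hω) 0
    simp only [NNReal.coe_zero, mul_zero, Real.exp_zero, ENNReal.ofReal_one, one_mul,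
      ENNReal.coe_zero] at h2
    have h3 := measure_sdiff (μ := P) (inter_subset_left (s := {ω | h n ω = c})
      (t := {ω | 0 < ξ n ω})) ((hc.jumpHistory_le n _ (measurableSet_state n c)).inter
        (measurableSet_lt measurable_const (hc.measurable_hold n))).nullMeasurableSet
        (measure_ne_top _ _)
    rw [h2, tsub_self] at h3
    refine measure_mono_null (fun ω hω => ?_) h3
    simp only [mem_compl_iff, mem_ofPred_eq, Classical.not_imp] at hω
    exact ⟨hω.1, fun h => hω.2 h.2⟩
  filter_upwards [ae_all_iff.2 h1] with ω hω using hω _ rfl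

/-- Given the present state, the time of arrival in it and the holding time are independent. -/
theorem map_jumpTime_hold (hc : IsJumpChain L a P h ξ) (hL : IsRateOperator L) {n : ℕ} {c : S}
    {E : Set Ω} {w : ℝ≥0∞} (hw : w ≠ ∞)
    (hstep : ∀ B : Set Ω, MeasurableSet[jumpHistory h ξ n] B → (∀ ω ∈ B, h n ω = c) →
      ∀ s : ℝ≥0, P (B ∩ E ∩ {ω | (s : ℝ≥0∞) < ξ n ω}) =
        ENNReal.ofReal (Real.exp (-exitRate L c * s)) * w * P B)
    {ν : Measure ℝ≥0∞} [IsProbabilityMeasure ν]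
    (hν : ∀ s : ℝ≥0, ν (Ioi (s : ℝ≥0∞)) = ENNReal.ofReal (Real.exp (-exitRate L c * s))) :
    (P.restrict ({ω | h n ω = c} ∩ E)).map (fun ω => (jumpTime ξ n ω, ξ n ω)) =
      w • ((P.restrict {ω | h n ω = c}).map (jumpTime ξ n)).prod ν := by
  have : IsFiniteMeasure (w • (P.restrict {ω | h n ω = c}).map (jumpTime ξ n)) :=
    Measure.smul_finite _ hw
  rw [← Measure.prod_smul_left]
  symm
  refine Measure.prod_eq fun A T hA hT => ?_
  set B : Set Ω := {ω | h n ω = c} ∩ jumpTime ξ n ⁻¹' A with hBdef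
  have hB : MeasurableSet[jumpHistory h ξ n] B :=
    (measurableSet_state n c).inter (measurable_jumpTime_history n hA)
  have hB' := hc.jumpHistory_le n B hB
  have hlaw : (P.restrict (B ∩ E)).map (ξ n) = (w * P B) • ν := by
    have hIoi : ∀ s : ℝ≥0, (P.restrict (B ∩ E)).map (ξ n) (Ioi (s : ℝ≥0∞)) =
        ((w * P B) • ν) (Ioi (s : ℝ≥0∞)) := by
      intro s
      rw [Measure.map_apply (hc.measurable_hold n) measurableSet_Ioi,
        Measure.restrict_apply (hc.measurable_hold n measurableSet_Ioi), inter_comm,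
        Measure.smul_apply, hν, smul_eq_mul]
      refine (hstep B hB (fun ω hω => hω.1) s).trans (by ring)
    -- The tails over s ≥ 0 do not see the point 0. Total masses agree because holding times are
    -- almost surely positive and ν gives full mass to (0,∞]; complements then give all the rays
    -- that determine a measure.
    have huniv : (P.restrict (B ∩ E)).map (ξ n) univ = ((w * P B) • ν) univ := by
      have h0 := hIoi 0
      have e1 : (P.restrict (B ∩ E)).map (ξ n) univ =
          (P.restrict (B ∩ E)).map (ξ n) (Ioi ((0 : ℝ≥0) : ℝ≥0∞)) := by
        rw [Measure.map_apply (hc.measurable_hold n) MeasurableSet.univ,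
          Measure.map_apply (hc.measurable_hold n) measurableSet_Ioi]
        refine measure_congr ?_
        filter_upwards [ae_restrict_of_ae (hc.hold_pos hL n)] with ω hω
        exact propext ⟨fun _ => hω, fun _ => trivial⟩
      rw [e1, h0, Measure.smul_apply, Measure.smul_apply, hν]
      simp
    refine Measure.ext_of_Iic _ _ fun x => ?_
    have hfin : IsFiniteMeasure ((w * P B) • ν) :=
      Measure.smul_finite _ (ENNReal.mul_ne_top hw (measure_ne_top _ _))
    induction x with
    | top => simpa using huniv
    | coe x => 
      rw [← compl_Ioi, measure_compl measurableSet_Ioi (measure_ne_top _ _),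
        measure_compl measurableSet_Ioi (measure_ne_top _ _), hIoi, huniv]
  have hpair : Measurable fun ω => (jumpTime ξ n ω, ξ n ω) :=
    (hc.measurable_jumpTime n).prodMk (hc.measurable_hold n)
  rw [Measure.map_apply hpair (hA.prod hT), Measure.restrict_apply (hpair (hA.prod hT)),
    Measure.smul_apply, Measure.map_apply (hc.measurable_jumpTime n) hA,
    Measure.restrict_apply (hc.measurable_jumpTime n hA), smul_eq_mul]
  have h1 := congrArg (fun μ : Measure ℝ≥0∞ => μ T) hlaw
  simp only [Measure.map_apply (hc.measurable_hold n) hT,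
    Measure.restrict_apply (hc.measurable_hold n hT), Measure.smul_apply, smul_eq_mul] at h1
  rw [inter_comm (jumpTime ξ n ⁻¹' A), ← hBdef, ← h1]
  congr 1
  ext ω
  simp only [hBdef, mem_inter_iff, mem_preimage, mem_prod, mem_ofPred_eq]
  tauto

/-- The expected number of transitions from `c` to `b` at the jump number `n + 1` up to time `t`
is the rate times the expected time spent in `c` after `n` jumps. -/
theorem measure_transition (hc : IsJumpChain L a P h ξ) (hL : IsRateOperator L) (n : ℕ) (c b : S)
    {t : ℝ} (ht : 0 ≤ t) :
    P ({ω | h n ω = c} ∩ {ω | h (n + 1) ω = b} ∩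
        {ω | jumpTime ξ (n + 1) ω ≤ ENNReal.ofReal t}) =
      eRate L c b * ∫⁻ s in Ioc 0 t, P ({ω | h n ω = c} ∩ jumpSlot ξ n s) := by
  have hCm := hc.jumpHistory_le n _ (measurableSet_state (h := h) (ξ := ξ) n c)
  have hbm : MeasurableSet {ω | h (n + 1) ω = b} :=
    hc.measurable_state (n + 1) (measurableSet_singleton b)
  by_cases h0 : P {ω | h n ω = c} = 0
  · have h1 : ∀ A, P ({ω | h n ω = c} ∩ A) = 0 := fun A =>
      measure_mono_null inter_subset_left h0
    simp [inter_assoc, h1]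
  -- The conditional law of the hold itself serves as the exponential law, so exit rate zero, where
  -- it is the point mass at ∞, needs no separate case.
  let ν : Measure ℝ≥0∞ := (P {ω | h n ω = c})⁻¹ • (P.restrict {ω | h n ω = c}).map (ξ n)
  have hνapp : ∀ T, MeasurableSet T →
      ν T = (P {ω | h n ω = c})⁻¹ * P ({ω | h n ω = c} ∩ ξ n ⁻¹' T) := by
    intro T hT
    simp only [ν, Measure.smul_apply, smul_eq_mul]
    rw [Measure.map_apply (hc.measurable_hold n) hT,
      Measure.restrict_apply (hc.measurable_hold n hT), inter_comm]
  have hνp : IsProbabilityMeasure ν := ⟨by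
    rw [hνapp _ MeasurableSet.univ, preimage_univ, inter_univ]
    exact ENNReal.inv_mul_cancel h0 (measure_ne_top _ _)⟩
  have hν : ∀ s : ℝ≥0, ν (Ioi (s : ℝ≥0∞)) =
      ENNReal.ofReal (Real.exp (-exitRate L c * s)) := by
    intro s
    rw [hνapp _ measurableSet_Ioi]
    have h1 := hc.measure_hold hL (measurableSet_state (h := h) (ξ := ξ) n c)
      (fun _ hω => hω) s
    change _ * P ({ω | h n ω = c} ∩ {ω | (s : ℝ≥0∞) < ξ n ω}) = _
    rw [h1, mul_comm, mul_assoc, ENNReal.mul_inv_cancel h0 (measure_ne_top _ _), mul_one]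
  have hpair : Measurable fun ω => (jumpTime ξ n ω, ξ n ω) :=
    (hc.measurable_jumpTime n).prodMk (hc.measurable_hold n)
  -- Two instances of the same independence statement: with the next state fixed, for the transition
  -- count, and with it free, for the time spent in c. They share the product measure up to the
  -- factor `jumpProb L c b`.
  have law1 := hc.map_jumpTime_hold hL (n := n) (c := c)
    (w := ENNReal.ofReal (jumpProb L c b)) ENNReal.ofReal_ne_top
    (fun B hB hBc s => hc.measure_step hB hBc b s) hν
  have law2 := hc.map_jumpTime_hold hL (n := n) (c := c) (E := univ)
    (w := 1) ENNReal.one_ne_top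
    (fun B hB hBc s => by rw [inter_univ, mul_one]; exact hc.measure_hold hL hB hBc s) hν
  set μ := (P.restrict {ω | h n ω = c}).map (jumpTime ξ n) with hμ
  rw [inter_univ, one_smul] at law2
  have hD : MeasurableSet {x : ℝ≥0∞ × ℝ≥0∞ | x.1 + x.2 ≤ ENNReal.ofReal t} :=
    measurableSet_le (measurable_fst.add measurable_snd) measurable_const
  have lhs : P ({ω | h n ω = c} ∩ {ω | h (n + 1) ω = b} ∩
        {ω | jumpTime ξ (n + 1) ω ≤ ENNReal.ofReal t}) =
      ENNReal.ofReal (jumpProb L c b) * ∫⁻ y, ν {z | y + z ≤ ENNReal.ofReal t} ∂μ := by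
    have h1 := congrArg (fun κ : Measure (ℝ≥0∞ × ℝ≥0∞) =>
      κ {x : ℝ≥0∞ × ℝ≥0∞ | x.1 + x.2 ≤ ENNReal.ofReal t}) law1
    simp only [Measure.map_apply hpair hD, Measure.restrict_apply (hpair hD),
      Measure.smul_apply, smul_eq_mul] at h1
    rw [Measure.prod_apply hD, inter_comm] at h1
    simp only [jumpTime_succ]
    exact h1
  have hF : ∀ s : ℝ, MeasurableSet {x : ℝ≥0∞ × ℝ≥0∞ |
      x.1 ≤ ENNReal.ofReal s ∧ ENNReal.ofReal s < x.1 + x.2} := fun s =>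
    (measurableSet_le measurable_fst measurable_const).inter
      (measurableSet_lt measurable_const (measurable_fst.add measurable_snd))
  have rhs : ∀ s : ℝ, P ({ω | h n ω = c} ∩ jumpSlot ξ n s) =
      ∫⁻ y, ν {z | y ≤ ENNReal.ofReal s ∧ ENNReal.ofReal s < y + z} ∂μ := by
    intro s
    have h1 := congrArg (fun κ : Measure (ℝ≥0∞ × ℝ≥0∞) =>
      κ {x : ℝ≥0∞ × ℝ≥0∞ | x.1 ≤ ENNReal.ofReal s ∧ ENNReal.ofReal s < x.1 + x.2}) law2
    simp only [Measure.map_apply hpair (hF s), Measure.restrict_apply (hpair (hF s))] at h1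
    rw [Measure.prod_apply (hF s), inter_comm] at h1
    simp only [jumpSlot, jumpTime_succ]
    exact h1
  have hmeas : Measurable (Function.uncurry fun (s : ℝ) (y : ℝ≥0∞) =>
      ν {z | y ≤ ENNReal.ofReal s ∧ ENNReal.ofReal s < y + z}) := by
    have : MeasurableSet {x : (ℝ × ℝ≥0∞) × ℝ≥0∞ |
        x.1.2 ≤ ENNReal.ofReal x.1.1 ∧ ENNReal.ofReal x.1.1 < x.1.2 + x.2} := by
      have h1 : Measurable fun x : (ℝ × ℝ≥0∞) × ℝ≥0∞ => ENNReal.ofReal x.1.1 := by fun_prop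
      have h2 : Measurable fun x : (ℝ × ℝ≥0∞) × ℝ≥0∞ => x.1.2 := by fun_prop
      exact (measurableSet_le h2 h1).inter (measurableSet_lt h1 (h2.add measurable_snd))
    exact measurable_measure_prodMk_left this
  rw [lhs]
  simp only [rhs]
  rw [lintegral_lintegral_swap hmeas.aemeasurable]
  simp only [exponential_clock (hL.exitRate_nonneg c) hν _ ht]
  rw [lintegral_const_mul' _ _ ENNReal.ofReal_ne_top, eRate]
  ring

end IsJumpChain

end AbstractChain

/-! ### The forward equation and the Lyapunov bound -/

section AbstractChain

variable {S Ω : Type*}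

theorem setLIntegral_comp_countable [MeasurableSpace S] [MeasurableSpace Ω] [Countable S]
    [MeasurableSingletonClass S] {P : Measure Ω} {g : Ω → S} (hg : Measurable g) (F : S → ℝ≥0∞)
    (A : Set Ω) :
    ∫⁻ ω in A, F (g ω) ∂P = ∑' c, F c * P ({ω | g ω = c} ∩ A) := by
  rw [← lintegral_map (measurable_of_countable F) hg, lintegral_countable']
  refine tsum_congr fun c => ?_
  rw [Measure.map_apply hg (measurableSet_singleton c),
    Measure.restrict_apply (hg (measurableSet_singleton c))]
  rfl

/-- The expectation of `F` of the `n`-th state of the skeleton on the event that exactly `n` jumps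
have occurred at time `s`. -/
def slotExp [MeasurableSpace Ω] (P : Measure Ω) (h : ℕ → Ω → S) (ξ : ℕ → Ω → ℝ≥0∞)
    (F : S → ℝ≥0∞) (n : ℕ) (s : ℝ) : ℝ≥0∞ :=
  ∫⁻ ω in jumpSlot ξ n s, F (h n ω) ∂P

/-- The rate at which `F` of the new state is collected at the jumps from `c`. -/
def jumpGain (L : (S → ℝ) → (S → ℝ)) (F : S → ℝ≥0∞) (c : S) : ℝ≥0∞ :=
  ∑' b, eRate L c b * F b

/-- The rate at which `F` of the old state is lost at the jumps from `c`. -/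
def jumpLoss (L : (S → ℝ) → (S → ℝ)) (F : S → ℝ≥0∞) (c : S) : ℝ≥0∞ :=
  ENNReal.ofReal (exitRate L c) * F c

/-- The exponential solves y = 1 + C∫y exactly; this reproduces the bound in the induction of
`lyapunov_partial` and replaces Grönwall's inequality. -/
theorem lintegral_exp_growth {C t : ℝ} (hC : 0 ≤ C) (ht : 0 ≤ t) :
    1 + ENNReal.ofReal C * ∫⁻ s in Ioc 0 t, ENNReal.ofReal (Real.exp (C * s)) =
      ENNReal.ofReal (Real.exp (C * t)) := by
  rw [← lintegral_const_mul' _ _ ENNReal.ofReal_ne_top]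
  simp only [← ENNReal.ofReal_mul hC]
  have hc : Continuous fun s : ℝ => C * Real.exp (C * s) := by fun_prop
  rw [← ofReal_integral_eq_lintegral_ofReal ((hc.integrableOn_Icc).mono_set Ioc_subset_Icc_self)
    (Filter.Eventually.of_forall fun s => mul_nonneg hC (Real.exp_pos _).le),
    ← intervalIntegral.integral_of_le ht,
    intervalIntegral.integral_eq_sub_of_hasDerivAt (f := fun s => Real.exp (C * s))]
  · rw [mul_zero, Real.exp_zero, ENNReal.ofReal_sub _ zero_le_one, ENNReal.ofReal_one]
    refine add_tsub_cancel_of_le ?_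
    rw [← ENNReal.ofReal_one]
    exact ENNReal.ofReal_le_ofReal (Real.one_le_exp (by positivity))
  · intro s _
    have h1 : HasDerivAt (fun s : ℝ => C * s) C s := by
      simpa using (hasDerivAt_id s).const_mul C
    exact h1.exp.congr_deriv (by ring)
  · exact hc.intervalIntegrable _ _

variable [MeasurableSpace S] [MeasurableSpace Ω]
  {L : (S → ℝ) → (S → ℝ)} {a : S} {P : Measure Ω} {h : ℕ → Ω → S} {ξ : ℕ → Ω → ℝ≥0∞}

namespace IsJumpChain

variable [IsProbabilityMeasure P] [MeasurableSingletonClass S] [Countable S]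

theorem measurable_slotExp (hc : IsJumpChain L a P h ξ) (F : S → ℝ≥0∞) (n : ℕ) :
    Measurable (slotExp P h ξ F n) := by
  have h1 : Measurable fun x : ℝ × Ω =>
      {x : ℝ × Ω | x.2 ∈ jumpSlot ξ n x.1}.indicator (fun x => F (h n x.2)) x :=
    (((measurable_of_countable F).comp (hc.measurable_state n)).comp measurable_snd).indicator
      (hc.measurableSet_jumpSlot_prod n)
  convert h1.lintegral_prod_right' (ν := P) using 2 with s
  rw [slotExp, ← lintegral_indicator (hc.measurableSet_jumpSlot n s)]
  rfl

/-- Sums `measure_transition` over all pairs of states. A weight read at the old state yields the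
loss from slot n, a weight read at the new state the gain of slot n + 1. -/
theorem lintegral_transition (hc : IsJumpChain L a P h ξ) (hL : IsRateOperator L)
    (g : S → S → ℝ≥0∞) (n : ℕ) {t : ℝ} (ht : 0 ≤ t) :
    ∫⁻ ω in {ω | jumpTime ξ (n + 1) ω ≤ ENNReal.ofReal t}, g (h n ω) (h (n + 1) ω) ∂P =
      ∫⁻ s in Ioc 0 t, slotExp P h ξ (fun c => ∑' b, eRate L c b * g c b) n s := by
  have hm : ∀ c, Measurable fun s => P ({ω | h n ω = c} ∩ jumpSlot ξ n s) := by
    intro c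
    have h1 := hc.measurable_slotExp (({c} : Set S).indicator fun _ => 1) n
    convert h1 using 2 with s
    rw [slotExp, setLIntegral_comp_countable (hc.measurable_state n),
      tsum_eq_single c (fun b hb => by simp [hb])]
    simp
  have h1 := setLIntegral_comp_countable (P := P)
    ((hc.measurable_state n).prodMk (hc.measurable_state (n + 1))) (fun p => g p.1 p.2)
    {ω | jumpTime ξ (n + 1) ω ≤ ENNReal.ofReal t}
  refine h1.trans ?_
  rw [ENNReal.tsum_prod (f := fun c b => g c b * P ({ω | (h n ω, h (n + 1) ω) = (c, b)} ∩
    {ω | jumpTime ξ (n + 1) ω ≤ ENNReal.ofReal t}))]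
  have h2 : ∀ c b, {ω | (h n ω, h (n + 1) ω) = (c, b)} ∩
      {ω | jumpTime ξ (n + 1) ω ≤ ENNReal.ofReal t} =
      {ω | h n ω = c} ∩ {ω | h (n + 1) ω = b} ∩
        {ω | jumpTime ξ (n + 1) ω ≤ ENNReal.ofReal t} := by
    intro c b; ext ω; simp
  simp only [h2, hc.measure_transition hL n _ _ ht]
  have h3 : ∀ s, slotExp P h ξ (fun c => ∑' b, eRate L c b * g c b) n s =
      ∑' c, (∑' b, eRate L c b * g c b) * P ({ω | h n ω = c} ∩ jumpSlot ξ n s) := fun s =>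
    setLIntegral_comp_countable (hc.measurable_state n) (fun c => ∑' b, eRate L c b * g c b) _
  simp only [h3]
  rw [lintegral_tsum fun c => ((hm c).const_mul _).aemeasurable]
  refine tsum_congr fun c => ?_
  rw [lintegral_const_mul _ (hm c), ← ENNReal.tsum_mul_right]
  exact tsum_congr fun b => by ring

/-- A path that has made its n-th jump by time t is either still in slot n or has already left it.
-/
theorem slotExp_add_lintegral (hc : IsJumpChain L a P h ξ) (hL : IsRateOperator L)
    (F : S → ℝ≥0∞) (n : ℕ) {t : ℝ} (ht : 0 ≤ t) :
    slotExp P h ξ F n t + ∫⁻ s in Ioc 0 t, slotExp P h ξ (jumpLoss L F) n s =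
      ∫⁻ ω in {ω | jumpTime ξ n ω ≤ ENNReal.ofReal t}, F (h n ω) ∂P := by
  have h1 := hc.lintegral_transition hL (fun c _ => F c) n ht
  simp only [ENNReal.tsum_mul_right, hL.tsum_eRate] at h1
  have h2 : (jumpLoss L F) = fun c => ENNReal.ofReal (exitRate L c) * F c := rfl
  rw [h2, ← h1, slotExp, ← lintegral_union]
  · congr 2
    ext ω
    simp only [jumpSlot, mem_union, mem_ofPred_eq]
    have h3 : jumpTime ξ n ω ≤ jumpTime ξ (n + 1) ω := by
      rw [jumpTime_succ]; exact le_self_add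
    constructor
    · rintro (h | h)
      exacts [h.1, h3.trans h]
    · intro h
      rcases lt_or_ge (ENNReal.ofReal t) (jumpTime ξ (n + 1) ω) with h4 | h4
      exacts [Or.inl ⟨h, h4⟩, Or.inr h4]
  · exact measurableSet_le (hc.measurable_jumpTime _) measurable_const
  · exact Set.disjoint_left.2 fun ω h1 h2 => absurd h2 (not_le.2 h1.2)

theorem balance_zero (hc : IsJumpChain L a P h ξ) (hL : IsRateOperator L)
    (F : S → ℝ≥0∞) {t : ℝ} (ht : 0 ≤ t) :
    slotExp P h ξ F 0 t + ∫⁻ s in Ioc 0 t, slotExp P h ξ (jumpLoss L F) 0 s = F a := by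
  rw [hc.slotExp_add_lintegral hL F 0 ht]
  have h1 : {ω | jumpTime ξ 0 ω ≤ ENNReal.ofReal t} = univ := by
    ext ω; simp [jumpTime]
  rw [h1, Measure.restrict_univ, lintegral_congr_ae (g := fun _ => F a)]
  · simp
  · filter_upwards [hc.start] with ω hω
    rw [hω]

theorem balance_succ (hc : IsJumpChain L a P h ξ) (hL : IsRateOperator L)
    (F : S → ℝ≥0∞) (n : ℕ) {t : ℝ} (ht : 0 ≤ t) :
    slotExp P h ξ F (n + 1) t + ∫⁻ s in Ioc 0 t, slotExp P h ξ (jumpLoss L F) (n + 1) s =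
      ∫⁻ s in Ioc 0 t, slotExp P h ξ (jumpGain L F) n s := by
  rw [hc.slotExp_add_lintegral hL F (n + 1) ht]
  exact hc.lintegral_transition hL (fun _ b => F b) n ht

/-- The expectation of `F` of the state at time `t`, on the event that there is no explosion up to
time `t`, satisfies the forward equation. -/
theorem balance (hc : IsJumpChain L a P h ξ) (hL : IsRateOperator L)
    (F : S → ℝ≥0∞) {t : ℝ} (ht : 0 ≤ t) :
    ∑' n, slotExp P h ξ F n t + ∫⁻ s in Ioc 0 t, ∑' n, slotExp P h ξ (jumpLoss L F) n s =
      F a + ∫⁻ s in Ioc 0 t, ∑' n, slotExp P h ξ (jumpGain L F) n s := by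
  rw [lintegral_tsum fun n => (hc.measurable_slotExp _ n).aemeasurable,
    lintegral_tsum fun n => (hc.measurable_slotExp _ n).aemeasurable, ← ENNReal.tsum_add,
    tsum_eq_zero_add' ENNReal.summable, hc.balance_zero hL F ht]
  simp only [hc.balance_succ hL F _ ht]

/-- The gain has one term fewer because slot n + 1 is fed by slot n alone. This shift is what makes
an induction on the number of slots possible. -/
theorem partial_balance (hc : IsJumpChain L a P h ξ) (hL : IsRateOperator L)
    (F : S → ℝ≥0∞) (N : ℕ) {t : ℝ} (ht : 0 ≤ t) :
    ∑ n ∈ Finset.range (N + 1), slotExp P h ξ F n t +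
        ∫⁻ s in Ioc 0 t, ∑ n ∈ Finset.range (N + 1), slotExp P h ξ (jumpLoss L F) n s =
      F a + ∫⁻ s in Ioc 0 t, ∑ n ∈ Finset.range N, slotExp P h ξ (jumpGain L F) n s := by
  rw [lintegral_finsetSum _ fun n _ => hc.measurable_slotExp _ n,
    lintegral_finsetSum _ fun n _ => hc.measurable_slotExp _ n, ← Finset.sum_add_distrib,
    Finset.sum_range_succ', hc.balance_zero hL F ht, add_comm]
  simp only [hc.balance_succ hL F _ ht]

/-- The gain of the first N slots is at most their loss plus C times their content, which the
induction hypothesis bounds. That loss is dominated by the loss of N + 1 slots on the left and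
cancels. Cancelling in [0,∞] requires it to be finite, so finiteness is carried through the
induction. -/
theorem lyapunov_partial (hc : IsJumpChain L a P h ξ) (hL : IsRateOperator L)
    {W : S → ℝ≥0∞} {C : ℝ} (hC : 0 ≤ C) (hWa : W a ≠ ∞)
    (hW : ∀ c, jumpGain L W c ≤ jumpLoss L W c + ENNReal.ofReal C * W c) (N : ℕ) :
    ∀ t : ℝ, 0 ≤ t →
      ∑ n ∈ Finset.range N, slotExp P h ξ W n t ≤ W a * ENNReal.ofReal (Real.exp (C * t)) ∧
      ∫⁻ s in Ioc 0 t, ∑ n ∈ Finset.range N, slotExp P h ξ (jumpLoss L W) n s ≠ ∞ := by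
  induction N with
  | zero => intro t ht; simp
  | succ N ih =>
    intro t ht
    obtain ⟨-, hfin⟩ := ih t ht
    have hb := hc.partial_balance hL W N ht
    have hgain : ∀ s, ∑ n ∈ Finset.range N, slotExp P h ξ (jumpGain L W) n s ≤
        ∑ n ∈ Finset.range N, slotExp P h ξ (jumpLoss L W) n s +
          ENNReal.ofReal C * ∑ n ∈ Finset.range N, slotExp P h ξ W n s := by
      intro s
      rw [Finset.mul_sum, ← Finset.sum_add_distrib]
      refine Finset.sum_le_sum fun n _ => ?_
      have hm : Measurable fun ω => jumpLoss L W (h n ω) :=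
        (measurable_of_countable (jumpLoss L W)).comp (hc.measurable_state n)
      rw [slotExp, slotExp, slotExp, ← lintegral_const_mul' _ _ ENNReal.ofReal_ne_top,
        ← lintegral_add_left hm]
      exact lintegral_mono fun ω => hW _
    have hint : ∫⁻ s in Ioc 0 t, ∑ n ∈ Finset.range N, slotExp P h ξ (jumpGain L W) n s ≤
        (∫⁻ s in Ioc 0 t, ∑ n ∈ Finset.range N, slotExp P h ξ (jumpLoss L W) n s) +
          ENNReal.ofReal C * ∫⁻ s in Ioc 0 t, W a * ENNReal.ofReal (Real.exp (C * s)) := by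
      rw [← lintegral_const_mul' _ _ ENNReal.ofReal_ne_top, ← lintegral_add_left
        (Finset.measurable_fun_sum _ fun n _ => hc.measurable_slotExp _ n)]
      refine setLIntegral_mono' measurableSet_Ioc fun s hs => (hgain s).trans ?_
      gcongr
      exact (ih s hs.1.le).1
    have hup : ∑ n ∈ Finset.range (N + 1), slotExp P h ξ W n t +
        ∫⁻ s in Ioc 0 t, ∑ n ∈ Finset.range (N + 1), slotExp P h ξ (jumpLoss L W) n s ≤
        W a * ENNReal.ofReal (Real.exp (C * t)) +
          ∫⁻ s in Ioc 0 t, ∑ n ∈ Finset.range N, slotExp P h ξ (jumpLoss L W) n s := by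
      rw [hb, ← lintegral_exp_growth hC ht]
      refine (add_le_add_right hint _).trans (le_of_eq ?_)
      rw [lintegral_const_mul' _ _ hWa]
      ring
    have hmono : ∫⁻ s in Ioc 0 t, ∑ n ∈ Finset.range N, slotExp P h ξ (jumpLoss L W) n s ≤
        ∫⁻ s in Ioc 0 t, ∑ n ∈ Finset.range (N + 1), slotExp P h ξ (jumpLoss L W) n s :=
      lintegral_mono fun s => Finset.sum_le_sum_of_subset (Finset.range_mono N.le_succ)
    refine ⟨(ENNReal.add_le_add_iff_right hfin).1 ((add_le_add_right hmono _).trans hup),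
      ne_top_of_le_ne_top ?_ (le_add_self.trans hup)⟩
    exact ENNReal.add_ne_top.2 ⟨ENNReal.mul_ne_top hWa ENNReal.ofReal_ne_top, hfin⟩

theorem lyapunov (hc : IsJumpChain L a P h ξ) (hL : IsRateOperator L)
    {W : S → ℝ≥0∞} {C : ℝ} (hC : 0 ≤ C) (hWa : W a ≠ ∞)
    (hW : ∀ c, jumpGain L W c ≤ jumpLoss L W c + ENNReal.ofReal C * W c) {t : ℝ} (ht : 0 ≤ t) :
    ∑' n, slotExp P h ξ W n t ≤ W a * ENNReal.ofReal (Real.exp (C * t)) := by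
  rw [ENNReal.tsum_eq_iSup_nat]
  exact iSup_le fun N => (hc.lyapunov_partial hL hC hWa hW N t ht).1

end IsJumpChain

end AbstractChain

/-! ### Non-explosion, the regular version and Dynkin's formula -/

section AbstractChain

variable {S Ω : Type*}

theorem jumpTime_mono (ξ : ℕ → Ω → ℝ≥0∞) (ω : Ω) : Monotone fun n => jumpTime ξ n ω :=
  monotone_nat_of_le_succ fun n => by rw [jumpTime_succ]; exact le_self_add

theorem disjoint_jumpSlot (ξ : ℕ → Ω → ℝ≥0∞) (s : ℝ) :
    Pairwise (Function.onFun Disjoint fun n => jumpSlot ξ n s) := by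
  refine (pairwise_disjoint_on _).2 fun m n hmn => ?_
  refine Set.disjoint_left.2 fun ω h1 h2 => ?_
  exact absurd (h1.2.trans_le (jumpTime_mono ξ ω (Nat.succ_le_of_lt hmn))) (not_lt.2 h2.1)

theorem exists_mem_jumpSlot {ξ : ℕ → Ω → ℝ≥0∞} {ω : Ω} {s : ℝ}
    (h : ∃ n, ENNReal.ofReal s < jumpTime ξ n ω) : ∃ n, ω ∈ jumpSlot ξ n s := by
  classical
  have h0 : Nat.find h ≠ 0 := by
    intro h0
    have := Nat.find_spec h
    rw [h0] at this
    simp [jumpTime] at this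
  obtain ⟨n, hn⟩ := Nat.exists_eq_succ_of_ne_zero h0
  refine ⟨n, not_lt.1 (Nat.find_min h (m := n) (by omega)), ?_⟩
  have := Nat.find_spec h
  rwa [hn] at this

/-- `Y` is a jointly measurable version of the process `X`, which does not explode, and whose
one-dimensional distributions satisfy the forward equation of the generator `L`. -/
structure IsRegularVersion [MeasurableSpace S] [MeasurableSpace Ω] (L : (S → ℝ) → (S → ℝ)) (a : S)
    (P : Measure Ω) (X : ℝ≥0 → Ω → S) (Y : ℝ × Ω → S) : Prop where
  measurable : Measurable Y
  eq_version : ∀ᵐ ω ∂P, ∀ s : ℝ, X s.toNNReal ω = Y (s, ω)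
  balance : ∀ (F : S → ℝ≥0∞) (t : ℝ), 0 ≤ t →
    ∫⁻ ω, F (Y (t, ω)) ∂P + ∫⁻ s in Ioc 0 t, ∫⁻ ω, jumpLoss L F (Y (s, ω)) ∂P =
      F a + ∫⁻ s in Ioc 0 t, ∫⁻ ω, jumpGain L F (Y (s, ω)) ∂P
  lyapunov : ∀ (W : S → ℝ≥0∞) (C : ℝ), 0 ≤ C → W a ≠ ∞ →
    (∀ c, jumpGain L W c ≤ jumpLoss L W c + ENNReal.ofReal C * W c) → ∀ t : ℝ, 0 ≤ t →
      ∫⁻ ω, W (Y (t, ω)) ∂P ≤ W a * ENNReal.ofReal (Real.exp (C * t))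

variable [MeasurableSpace S] [MeasurableSpace Ω]
  {L : (S → ℝ) → (S → ℝ)} {a : S} {P : Measure Ω}

section

variable {h : ℕ → Ω → S} {ξ : ℕ → Ω → ℝ≥0∞} [IsProbabilityMeasure P]
  [MeasurableSingletonClass S] [Countable S]

/-- For F = 1 gain and loss are both the exit rate. Its time integral is finite by the Lyapunov
bound, so it cancels from the balance and the slots at time t have total probability 1. Integer
times suffice, since survival up to m implies survival up to every s ≤ m. -/
theorem IsJumpChain.nonexplosion (hc : IsJumpChain L a P h ξ) (hL : IsRateOperator L)
    {W : S → ℝ≥0∞} {C : ℝ} (hC : 0 ≤ C) (hWa : W a ≠ ∞)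
    (hW : ∀ c, jumpGain L W c ≤ jumpLoss L W c + ENNReal.ofReal C * W c)
    {K : ℝ≥0∞} (hK : K ≠ ∞) (hqW : ∀ c, ENNReal.ofReal (exitRate L c) ≤ K * W c) :
    ∀ᵐ ω ∂P, ∀ s : ℝ, ∃ n, ω ∈ jumpSlot ξ n s := by
  have key : ∀ t : ℝ, 0 ≤ t → ∀ᵐ ω ∂P, ∃ n, ω ∈ jumpSlot ξ n t := by
    intro t ht
    have h1 := hc.balance hL (fun _ => 1) ht
    have h2 : jumpGain L (fun _ => 1) = jumpLoss L (fun _ => (1 : ℝ≥0∞)) := by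
      funext c
      simp [jumpGain, jumpLoss, hL.tsum_eRate]
    have hbd : ∀ s ∈ Ioc 0 t, ∑' n, slotExp P h ξ (jumpLoss L fun _ => 1) n s ≤
        K * (W a * ENNReal.ofReal (Real.exp (C * t))) := by
      intro s hs
      have h3 : ∀ n, slotExp P h ξ (jumpLoss L fun _ => 1) n s ≤ K * slotExp P h ξ W n s := by
        intro n
        rw [slotExp, slotExp, ← lintegral_const_mul' _ _ hK]
        refine lintegral_mono fun ω => ?_
        simpa [jumpLoss] using hqW (h n ω)
      refine (ENNReal.tsum_le_tsum h3).trans ?_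
      rw [ENNReal.tsum_mul_left]
      gcongr
      refine (hc.lyapunov hL hC hWa hW hs.1.le).trans ?_
      gcongr
      exact hs.2
    have hfin : ∫⁻ s in Ioc 0 t, ∑' n, slotExp P h ξ (jumpLoss L fun _ => 1) n s ≠ ∞ := by
      refine ne_top_of_le_ne_top ?_ (setLIntegral_mono' measurableSet_Ioc hbd)
      rw [setLIntegral_const]
      exact ENNReal.mul_ne_top (ENNReal.mul_ne_top hK
        (ENNReal.mul_ne_top hWa ENNReal.ofReal_ne_top)) (by simp)
    rw [h2, ENNReal.add_left_inj hfin] at h1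
    simp only [slotExp, lintegral_const, one_mul, Measure.restrict_apply MeasurableSet.univ,
      univ_inter] at h1
    rw [← measure_iUnion (disjoint_jumpSlot ξ t) fun n => hc.measurableSet_jumpSlot n t] at h1
    have h4 := (prob_compl_eq_zero_iff
      (MeasurableSet.iUnion fun n => hc.measurableSet_jumpSlot n t)).2 h1
    filter_upwards [compl_mem_ae_iff.2 h4] with ω hω
    simpa using hω
  have h1 : ∀ᵐ ω ∂P, ∀ m : ℕ, ∃ n, ω ∈ jumpSlot ξ n (m : ℝ) :=
    ae_all_iff.2 fun m => key m m.cast_nonneg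
  filter_upwards [h1] with ω hω s
  obtain ⟨m, hm⟩ := exists_nat_ge s
  obtain ⟨n, hn⟩ := hω m
  exact exists_mem_jumpSlot ⟨n + 1, (ENNReal.ofReal_le_ofReal hm).trans_lt hn.2⟩

theorem IsMarkovJumpProcess.exists_regularVersion {X : ℝ≥0 → Ω → S}
    (hX : IsMarkovJumpProcess L a P X) (hL : IsRateOperator L)
    {W : S → ℝ≥0∞} {C : ℝ} (hC : 0 ≤ C) (hWa : W a ≠ ∞)
    (hW : ∀ c, jumpGain L W c ≤ jumpLoss L W c + ENNReal.ofReal C * W c)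
    {K : ℝ≥0∞} (hK : K ≠ ∞) (hqW : ∀ c, ENNReal.ofReal (exitRate L c) ≤ K * W c) :
    ∃ Y : ℝ × Ω → S, IsRegularVersion L a P X Y := by
  classical
  obtain ⟨h, ξ, hc, hpath⟩ := hX
  have hne := hc.nonexplosion hL hC hWa hW hK hqW
  -- The second alternative makes the search succeed everywhere, with index 0 on the paths that have
  -- exploded; thus `Y` is total and jointly measurable, which is not known of `X`.
  have hex : ∀ x : ℝ × Ω, ∃ n, x.2 ∈ jumpSlot ξ n x.1 ∨ ∀ k, x.2 ∉ jumpSlot ξ k x.1 := by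
    intro x
    by_cases hx : ∃ n, x.2 ∈ jumpSlot ξ n x.1
    · obtain ⟨n, hn⟩ := hx
      exact ⟨n, Or.inl hn⟩
    · exact ⟨0, Or.inr (not_exists.1 hx)⟩
  let Y : ℝ × Ω → S := fun x => h (Nat.find (hex x)) x.2
  have hYm : Measurable Y := by
    refine Measurable.find (f := fun n (x : ℝ × Ω) => h n x.2)
      (p := fun n (x : ℝ × Ω) => x.2 ∈ jumpSlot ξ n x.1 ∨ ∀ k, x.2 ∉ jumpSlot ξ k x.1)
      (fun n => (hc.measurable_state n).comp measurable_snd) (fun n => ?_) hex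
    have h1 : MeasurableSet {x : ℝ × Ω | ∀ k, x.2 ∉ jumpSlot ξ k x.1} := by
      simp only [ofPred_forall]
      exact MeasurableSet.iInter fun k => (hc.measurableSet_jumpSlot_prod k).compl
    exact (hc.measurableSet_jumpSlot_prod n).union h1
  have hYslot : ∀ (s : ℝ) (n : ℕ) (ω : Ω), ω ∈ jumpSlot ξ n s → Y (s, ω) = h n ω := by
    intro s n ω hω
    have h1 : ω ∈ jumpSlot ξ (Nat.find (hex (s, ω))) s :=
      (Nat.find_spec (hex (s, ω))).resolve_right fun h2 => h2 n hω
    have h2 : Nat.find (hex (s, ω)) = n := by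
      by_contra h3
      exact Set.disjoint_left.1 (disjoint_jumpSlot ξ s h3) h1 hω
    simp only [Y, h2]
  have hexp : ∀ (F : S → ℝ≥0∞) (s : ℝ),
      ∫⁻ ω, F (Y (s, ω)) ∂P = ∑' n, slotExp P h ξ F n s := by
    intro F s
    have h1 : (⋃ n, jumpSlot ξ n s) =ᵐ[P] univ := by
      filter_upwards [hne] with ω hω
      exact propext ⟨fun _ => trivial, fun _ => mem_iUnion.2 (hω s)⟩
    rw [← setLIntegral_univ, ← setLIntegral_congr h1,
      lintegral_iUnion (fun n => hc.measurableSet_jumpSlot n s) (disjoint_jumpSlot ξ s)]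
    refine tsum_congr fun n => ?_
    exact setLIntegral_congr_fun (hc.measurableSet_jumpSlot n s) fun ω hω => by
      simp only [hYslot s n ω hω]
  refine ⟨Y, hYm, ?_, ?_, ?_⟩
  · filter_upwards [hne, hpath] with ω h1 h2 s
    obtain ⟨n, hn⟩ := h1 s
    rw [hYslot s n ω hn]
    exact h2 n s.toNNReal hn.1 hn.2
  · intro F t ht
    simp only [hexp]
    exact hc.balance hL F ht
  · intro W C hC hWa hW t ht
    rw [hexp]
    exact hc.lyapunov hL hC hWa hW ht

end

namespace IsRegularVersion

variable {X : ℝ≥0 → Ω → S} {Y : ℝ × Ω → S}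

theorem lintegral_ne_top (hY : IsRegularVersion L a P X Y) {W : S → ℝ≥0∞} {C : ℝ} (hC : 0 ≤ C)
    (hWa : W a ≠ ∞) (hW : ∀ c, jumpGain L W c ≤ jumpLoss L W c + ENNReal.ofReal C * W c)
    {F : S → ℝ≥0∞} {K : ℝ≥0∞} (hK : K ≠ ∞) (hF : ∀ c, F c ≤ K * W c) {t : ℝ} (ht : 0 ≤ t) :
    ∫⁻ ω, F (Y (t, ω)) ∂P ≠ ∞ := by
  refine ne_top_of_le_ne_top ?_ (lintegral_mono fun ω => hF _)
  rw [lintegral_const_mul' _ _ hK]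
  exact ENNReal.mul_ne_top hK (ne_top_of_le_ne_top
    (ENNReal.mul_ne_top hWa ENNReal.ofReal_ne_top) (hY.lyapunov W C hC hWa hW t ht))

variable [MeasurableSingletonClass S] [Countable S]

theorem integrable (hY : IsRegularVersion L a P X Y) {W : S → ℝ≥0∞} {C : ℝ} (hC : 0 ≤ C)
    (hWa : W a ≠ ∞) (hW : ∀ c, jumpGain L W c ≤ jumpLoss L W c + ENNReal.ofReal C * W c)
    {Φ : S → ℝ} {K : ℝ≥0∞} (hK : K ≠ ∞) (hΦ : ∀ c, ‖Φ c‖ₑ ≤ K * W c) {t : ℝ} (ht : 0 ≤ t) :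
    Integrable (fun ω => Φ (Y (t, ω))) P :=
  ⟨(((measurable_of_countable Φ).comp hY.measurable).comp
      measurable_prodMk_left).aestronglyMeasurable,
    (hY.lintegral_ne_top hC hWa hW hK hΦ ht).lt_top⟩

variable [IsProbabilityMeasure P]

theorem lintegral_prod_le (hY : IsRegularVersion L a P X Y) {W : S → ℝ≥0∞} {C : ℝ} (hC : 0 ≤ C)
    (hWa : W a ≠ ∞) (hW : ∀ c, jumpGain L W c ≤ jumpLoss L W c + ENNReal.ofReal C * W c)
    {F : S → ℝ≥0∞} {K : ℝ≥0∞} (hK : K ≠ ∞) (hF : ∀ c, F c ≤ K * W c) {t : ℝ} :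
    ∫⁻ x, F (Y x) ∂((volume.restrict (Ioc 0 t)).prod P) ≠ ∞ := by
  have hFY : Measurable fun x => F (Y x) := (measurable_of_countable F).comp hY.measurable
  rw [lintegral_prod _ hFY.aemeasurable]
  have hbd : ∀ s ∈ Ioc 0 t, ∫⁻ ω, F (Y (s, ω)) ∂P ≤
      K * (W a * ENNReal.ofReal (Real.exp (C * t))) := by
    intro s hs
    refine (lintegral_mono fun ω => hF _).trans ?_
    rw [lintegral_const_mul' _ _ hK]
    gcongr
    refine (hY.lyapunov W C hC hWa hW s hs.1.le).trans ?_
    gcongr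
    exact hs.2
  refine ne_top_of_le_ne_top ?_ (setLIntegral_mono' measurableSet_Ioc hbd)
  rw [setLIntegral_const]
  exact ENNReal.mul_ne_top (ENNReal.mul_ne_top hK
    (ENNReal.mul_ne_top hWa ENNReal.ofReal_ne_top)) (by simp)

theorem integrable_prod (hY : IsRegularVersion L a P X Y) {W : S → ℝ≥0∞} {C : ℝ} (hC : 0 ≤ C)
    (hWa : W a ≠ ∞) (hW : ∀ c, jumpGain L W c ≤ jumpLoss L W c + ENNReal.ofReal C * W c)
    {Φ : S → ℝ} {K : ℝ≥0∞} (hK : K ≠ ∞) (hΦ : ∀ c, ‖Φ c‖ₑ ≤ K * W c) (t : ℝ) :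
    Integrable (fun x => Φ (Y x)) ((volume.restrict (Ioc 0 t)).prod P) :=
  ⟨((measurable_of_countable Φ).comp hY.measurable).aestronglyMeasurable,
    (hY.lintegral_prod_le hC hWa hW hK hΦ).lt_top⟩

/-- Dynkin's formula. -/
theorem dynkin (hY : IsRegularVersion L a P X Y) {W : S → ℝ≥0∞} {C : ℝ} (hC : 0 ≤ C)
    (hWa : W a ≠ ∞) (hW : ∀ c, jumpGain L W c ≤ jumpLoss L W c + ENNReal.ofReal C * W c)
    (hWf : ∀ c, W c ≠ ∞)
    {Φ Ψ : S → ℝ} {K : ℝ≥0∞} (hK : K ≠ ∞) (hΦ : ∀ c, ‖Φ c‖ₑ ≤ K * W c)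
    (hloss : ∀ c, jumpLoss L (fun c => ‖Φ c‖ₑ) c ≤ K * W c)
    (hgain : ∀ c, jumpGain L (fun c => ‖Φ c‖ₑ) c ≤ K * W c)
    (hΨ : ∀ c, Ψ c = (jumpGain L (fun c => ENNReal.ofReal (Φ c)) c).toReal -
      (jumpGain L (fun c => ENNReal.ofReal (-Φ c)) c).toReal -
      ((jumpLoss L (fun c => ENNReal.ofReal (Φ c)) c).toReal -
      (jumpLoss L (fun c => ENNReal.ofReal (-Φ c)) c).toReal)) {t : ℝ} (ht : 0 ≤ t) :
    ∫ ω, Φ (Y (t, ω)) ∂P = Φ a + ∫ s in (0 : ℝ)..t, ∫ ω, Ψ (Y (s, ω)) ∂P := by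
  set μ := (volume.restrict (Ioc 0 t)).prod P with hμ
  have hpos : ∀ r : ℝ, ENNReal.ofReal r ≤ ‖r‖ₑ := fun r => by
    rw [Real.enorm_eq_ofReal_abs]; exact ENNReal.ofReal_le_ofReal (le_abs_self r)
  have hneg : ∀ r : ℝ, ENNReal.ofReal (-r) ≤ ‖r‖ₑ := fun r => by
    rw [← enorm_neg]; exact hpos _
  have gmono : ∀ F : S → ℝ≥0∞, (∀ c, F c ≤ ‖Φ c‖ₑ) → ∀ c, jumpGain L F c ≤ K * W c :=
    fun F hF c => (ENNReal.tsum_le_tsum fun b => mul_le_mul_right (hF b) _).trans (hgain c)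
  have lmono : ∀ F : S → ℝ≥0∞, (∀ c, F c ≤ ‖Φ c‖ₑ) → ∀ c, jumpLoss L F c ≤ K * W c :=
    fun F hF c => (mul_le_mul_right (hF c) _).trans (hloss c)
  have meas : ∀ F : S → ℝ≥0∞, Measurable fun x => F (Y x) := fun F =>
    (measurable_of_countable F).comp hY.measurable
  have hprod : ∀ F : S → ℝ≥0∞, ∫⁻ s in Ioc 0 t, ∫⁻ ω, F (Y (s, ω)) ∂P = ∫⁻ x, F (Y x) ∂μ :=
    fun F => (lintegral_prod _ (meas F).aemeasurable).symm
  have toR : ∀ F : S → ℝ≥0∞, (∀ c, F c ≤ K * W c) →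
      Integrable (fun x => (F (Y x)).toReal) μ ∧
      ∫ x, (F (Y x)).toReal ∂μ = (∫⁻ x, F (Y x) ∂μ).toReal := by
    intro F hF
    refine ⟨integrable_toReal_of_lintegral_ne_top (meas F).aemeasurable
      (hY.lintegral_prod_le hC hWa hW hK hF), integral_toReal (meas F).aemeasurable ?_⟩
    exact Filter.Eventually.of_forall fun x =>
      (hF _).trans_lt (ENNReal.mul_ne_top hK (hWf _)).lt_top
  -- All four terms of the balance are finite through `W`, so it passes to ℝ; it is then used for
  -- the positive and the negative part of Φ and the two are subtracted.
  have bal : ∀ F : S → ℝ≥0∞, (∀ c, F c ≤ ‖Φ c‖ₑ) →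
      (∫⁻ ω, F (Y (t, ω)) ∂P).toReal + ∫ x, (jumpLoss L F (Y x)).toReal ∂μ =
        (F a).toReal + ∫ x, (jumpGain L F (Y x)).toReal ∂μ := by
    intro F hF
    have hF' : ∀ c, F c ≤ K * W c := fun c => (hF c).trans (hΦ c)
    rw [(toR _ (lmono F hF)).2, (toR _ (gmono F hF)).2,
      ← ENNReal.toReal_add (hY.lintegral_ne_top hC hWa hW hK hF' ht)
        (hY.lintegral_prod_le hC hWa hW hK (lmono F hF)),
      ← ENNReal.toReal_add (ne_top_of_le_ne_top (ENNReal.mul_ne_top hK hWa) (hF' a))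
        (hY.lintegral_prod_le hC hWa hW hK (gmono F hF)), ← hprod, ← hprod,
      hY.balance F t ht]
  have b1 := bal _ fun c => hpos (Φ c)
  have b2 := bal _ fun c => hneg (Φ c)
  have gp := (toR _ (gmono _ fun c => hpos (Φ c))).1
  have gn := (toR _ (gmono _ fun c => hneg (Φ c))).1
  have lp := (toR _ (lmono _ fun c => hpos (Φ c))).1
  have ln := (toR _ (lmono _ fun c => hneg (Φ c))).1
  have hΨY : (fun x => Ψ (Y x)) = fun x =>
      (jumpGain L (fun c => ENNReal.ofReal (Φ c)) (Y x)).toReal -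
      (jumpGain L (fun c => ENNReal.ofReal (-Φ c)) (Y x)).toReal -
      ((jumpLoss L (fun c => ENNReal.ofReal (Φ c)) (Y x)).toReal -
      (jumpLoss L (fun c => ENNReal.ofReal (-Φ c)) (Y x)).toReal) := funext fun x => hΨ _
  have hint : Integrable (fun x => Ψ (Y x)) μ := by
    rw [hΨY]; exact (gp.sub gn).sub (lp.sub ln)
  have hval : ∫ x, Ψ (Y x) ∂μ = ∫ s in (0 : ℝ)..t, ∫ ω, Ψ (Y (s, ω)) ∂P := by
    rw [intervalIntegral.integral_of_le ht, integral_prod _ hint]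
  have e1 := integral_sub gp gn
  have e2 := integral_sub lp ln
  have e3 := integral_sub (gp.sub gn) (lp.sub ln)
  simp only [Pi.sub_apply] at e3
  rw [← hval, hΨY, e3, e1, e2,
    integral_eq_lintegral_pos_part_sub_lintegral_neg_part (hY.integrable hC hWa hW hK hΦ ht)]
  have ha : (ENNReal.ofReal (Φ a)).toReal - (ENNReal.ofReal (-Φ a)).toReal = Φ a := by
    rcases le_total 0 (Φ a) with h | h
    · simp [h, ENNReal.ofReal_of_nonpos]
    · simp [h, ENNReal.ofReal_of_nonpos]
  linarith

end IsRegularVersion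

end AbstractChain

/-! ### Chains with finitely many moves from each state -/

section MoveOperator

variable {S Ω ι : Type*}

/-- The operator `L` describes a chain that makes from `c` the move `c → T i c` at rate `r i c`,
where only finitely many moves are possible from each state. -/
structure IsMoveOperator (L : (S → ℝ) → (S → ℝ)) (r : ι → S → ℝ) (T : ι → S → S)
    (supp : S → Finset ι) : Prop where
  rate_nonneg : ∀ i c, 0 ≤ r i c
  apply_eq : ∀ φ c, L φ c = ∑ i ∈ supp c, r i c * (φ (T i c) - φ c)

open Classical in
/-- The rates of the moves that change the state. -/
def effRate (r : ι → S → ℝ) (T : ι → S → S) (i : ι) (c : S) : ℝ :=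
  if T i c = c then 0 else r i c

theorem effRate_le {r : ι → S → ℝ} {T : ι → S → S} {i : ι} {c : S} (h : 0 ≤ r i c) :
    effRate r T i c ≤ r i c := by
  unfold effRate
  split_ifs
  exacts [h, le_rfl]

theorem effRate_nonneg {r : ι → S → ℝ} {T : ι → S → S} {i : ι} {c : S} (h : 0 ≤ r i c) :
    0 ≤ effRate r T i c := by
  unfold effRate
  split_ifs
  exacts [le_rfl, h]

theorem effRate_mul_sub (r : ι → S → ℝ) (T : ι → S → S) (i : ι) (c : S) (φ : S → ℝ) :
    effRate r T i c * (φ (T i c) - φ c) = r i c * (φ (T i c) - φ c) := by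
  unfold effRate
  split_ifs with h
  · simp [h]
  · rfl

namespace IsMoveOperator

variable {L : (S → ℝ) → (S → ℝ)} {r : ι → S → ℝ} {T : ι → S → S} {supp : S → Finset ι}

theorem apply_eq_effRate (hL : IsMoveOperator L r T supp) (φ : S → ℝ) (c : S) :
    L φ c = ∑ i ∈ supp c, effRate r T i c * (φ (T i c) - φ c) := by
  simp only [hL.apply_eq, effRate_mul_sub]

/-- A move that fixes the state is invisible to `L`. Such moves do occur: for instance an edge
joining two nodes outside V₀ acts trivially. -/
theorem exitRate_eq (hL : IsMoveOperator L r T supp) (c : S) :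
    exitRate L c = ∑ i ∈ supp c, effRate r T i c := by
  rw [exitRate, hL.apply_eq, ← Finset.sum_neg_distrib]
  refine Finset.sum_congr rfl fun i _ => ?_
  by_cases h : T i c = c
  · simp [effRate, h]
  · simp [effRate, h]

theorem exitRate_nonneg (hL : IsMoveOperator L r T supp) (c : S) : 0 ≤ exitRate L c := by
  rw [hL.exitRate_eq]
  exact Finset.sum_nonneg fun i _ => effRate_nonneg (hL.rate_nonneg i c)

open Classical in
theorem jumpRate_eq (hL : IsMoveOperator L r T supp) {c b : S} (hb : b ≠ c) :
    jumpRate L c b = ∑ i ∈ supp c, if T i c = b then effRate r T i c else 0 := by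
  rw [jumpRate, hL.apply_eq]
  refine Finset.sum_congr rfl fun i _ => ?_
  by_cases h : T i c = b
  · subst h
    simp [effRate, hb, hb.symm]
  · simp [h, hb.symm]

theorem jumpRate_nonneg (hL : IsMoveOperator L r T supp) {c b : S} (hb : b ≠ c) :
    0 ≤ jumpRate L c b := by
  classical
  rw [hL.jumpRate_eq hb]
  refine Finset.sum_nonneg fun i _ => ?_
  split_ifs
  exacts [effRate_nonneg (hL.rate_nonneg i c), le_rfl]

-- Multiplying by the exit rate undoes the normalisation in `jumpProb`; the convention for absorbing
-- states is harmless since there the factor is 0. Different moves may lead to the same state, hence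
-- the sum.
open Classical in
theorem eRate_eq (hL : IsMoveOperator L r T supp) (c b : S) :
    eRate L c b =
      ∑ i ∈ supp c, if T i c = b then ENNReal.ofReal (effRate r T i c) else 0 := by
  have hsum : ∑ i ∈ supp c, (if T i c = b then ENNReal.ofReal (effRate r T i c) else 0) =
      ENNReal.ofReal (∑ i ∈ supp c, if T i c = b then effRate r T i c else 0) := by
    rw [ENNReal.ofReal_sum_of_nonneg]
    · exact Finset.sum_congr rfl fun i _ => by split_ifs <;> simp
    · intro i _
      split_ifs
      exacts [effRate_nonneg (hL.rate_nonneg i c), le_rfl]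
  rw [hsum, eRate]
  by_cases h0 : exitRate L c = 0
  · rw [h0, ENNReal.ofReal_zero, zero_mul]
    rw [hL.exitRate_eq, Finset.sum_eq_zero_iff_of_nonneg fun i _ =>
      effRate_nonneg (hL.rate_nonneg i c)] at h0
    rw [Finset.sum_eq_zero, ENNReal.ofReal_zero]
    intro i hi
    simp [h0 i hi]
  · rw [← ENNReal.ofReal_mul (hL.exitRate_nonneg c), jumpProb, if_neg h0]
    congr 1
    by_cases hb : b = c
    · rw [if_pos hb, mul_zero, Finset.sum_eq_zero]
      intro i _
      subst hb
      exact ite_eq_right_iff.2 fun h => if_pos h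
    · rw [if_neg hb, mul_div_cancel₀ _ h0, hL.jumpRate_eq hb]

theorem jumpGain_eq (hL : IsMoveOperator L r T supp) (F : S → ℝ≥0∞) (c : S) :
    jumpGain L F c = ∑ i ∈ supp c, ENNReal.ofReal (effRate r T i c) * F (T i c) := by
  classical
  simp only [jumpGain, hL.eRate_eq, Finset.sum_mul]
  rw [Summable.tsum_finsetSum fun i _ => ENNReal.summable]
  refine Finset.sum_congr rfl fun i _ => ?_
  rw [tsum_eq_single (T i c) fun b hb => by simp [hb.symm]]
  simp

theorem ofReal_exitRate (hL : IsMoveOperator L r T supp) (c : S) :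
    ENNReal.ofReal (exitRate L c) = ∑ i ∈ supp c, ENNReal.ofReal (effRate r T i c) := by
  rw [hL.exitRate_eq, ENNReal.ofReal_sum_of_nonneg fun i _ => effRate_nonneg (hL.rate_nonneg i c)]

theorem isRateOperator (hL : IsMoveOperator L r T supp) : IsRateOperator L where
  exitRate_nonneg := hL.exitRate_nonneg
  jumpProb_nonneg c b := by
    unfold jumpProb
    split_ifs with h0 hb hb
    · exact zero_le_one
    · exact le_rfl
    · exact le_rfl
    · exact div_nonneg (hL.jumpRate_nonneg hb) (hL.exitRate_nonneg c)
  tsum_jumpProb c := by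
    by_cases h0 : exitRate L c = 0
    · rw [tsum_eq_single c fun b hb => by simp [jumpProb, h0, hb]]
      simp [jumpProb, h0]
    -- The gain of the constant 1 is the exit rate times the total jump probability, and also the
    -- sum of the effective rates, which is the exit rate.
    · have h1 := hL.jumpGain_eq (fun _ => 1) c
      simp only [jumpGain, eRate, mul_one, ← hL.ofReal_exitRate, ENNReal.tsum_mul_left] at h1
      have h2 : ENNReal.ofReal (exitRate L c) ≠ 0 := by
        simpa using lt_of_le_of_ne (hL.exitRate_nonneg c) (Ne.symm h0)
      exact (ENNReal.mul_right_inj h2 ENNReal.ofReal_ne_top).1 (by rw [h1, mul_one])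

variable {ρ : S → ℝ≥0∞} {K D : ℝ≥0}

theorem exitRate_le (hL : IsMoveOperator L r T supp)
    (hK : ∀ c, ∑ i ∈ supp c, ENNReal.ofReal (r i c) ≤ K * ρ c) (c : S) :
    ENNReal.ofReal (exitRate L c) ≤ K * ρ c := by
  rw [hL.ofReal_exitRate]
  exact (Finset.sum_le_sum fun i _ => ENNReal.ofReal_le_ofReal
    (effRate_le (hL.rate_nonneg i c))).trans (hK c)

/-- Since ρ ≥ 1, one move raises ρ² by at most (2D + D²)ρ, and the total rate is at most Kρ. The
square is used because the gain and loss of a function of size ρ are of order ρ². -/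
theorem lyapunov_sq (hL : IsMoveOperator L r T supp) (hρ : ∀ c, 1 ≤ ρ c)
    (hK : ∀ c, ∑ i ∈ supp c, ENNReal.ofReal (r i c) ≤ K * ρ c)
    (hD : ∀ i c, ρ (T i c) ≤ ρ c + D) (c : S) :
    jumpGain L (fun c => ρ c ^ 2) c ≤ jumpLoss L (fun c => ρ c ^ 2) c +
      ENNReal.ofReal ((K * (2 * D + D ^ 2) : ℝ≥0) : ℝ) * ρ c ^ 2 := by
  have hstep : ∀ i, ρ (T i c) ^ 2 ≤ ρ c ^ 2 + (2 * D + D ^ 2) * ρ c := by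
    intro i
    calc ρ (T i c) ^ 2 ≤ (ρ c + D) ^ 2 := by gcongr; exact hD i c
      _ = ρ c ^ 2 + 2 * D * ρ c + D ^ 2 * 1 := by ring
      _ ≤ ρ c ^ 2 + 2 * D * ρ c + D ^ 2 * ρ c := by gcongr; exact hρ c
      _ = _ := by ring
  rw [hL.jumpGain_eq, ENNReal.ofReal_coe_nnreal, jumpLoss]
  calc ∑ i ∈ supp c, ENNReal.ofReal (effRate r T i c) * ρ (T i c) ^ 2
      ≤ ∑ i ∈ supp c, ENNReal.ofReal (effRate r T i c) *
          (ρ c ^ 2 + (2 * D + D ^ 2) * ρ c) := by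
        gcongr with i _
        exact hstep i
    _ = ENNReal.ofReal (exitRate L c) * ρ c ^ 2 +
          ENNReal.ofReal (exitRate L c) * ((2 * D + D ^ 2) * ρ c) := by
        rw [← Finset.sum_mul, ← hL.ofReal_exitRate, mul_add]
    _ ≤ ENNReal.ofReal (exitRate L c) * ρ c ^ 2 + (K * ρ c) * ((2 * D + D ^ 2) * ρ c) := by
        gcongr
        exact hL.exitRate_le hK c
    _ = _ := by push_cast; ring

/-- A chain whose total rate is bounded by a multiple of a size function that increases by a
bounded amount at each jump has a regular version, for which functions bounded by the size are
integrable and satisfy Dynkin's formula. -/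
theorem exists_dynkin [Countable S] [MeasurableSpace S] [MeasurableSingletonClass S]
    [MeasurableSpace Ω] {P : Measure Ω} [IsProbabilityMeasure P] {a : S} {X : ℝ≥0 → Ω → S}
    (hX : IsMarkovJumpProcess L a P X) (hL : IsMoveOperator L r T supp)
    (hρ : ∀ c, 1 ≤ ρ c) (hρf : ∀ c, ρ c ≠ ∞)
    (hK : ∀ c, ∑ i ∈ supp c, ENNReal.ofReal (r i c) ≤ K * ρ c)
    (hD : ∀ i c, ρ (T i c) ≤ ρ c + D) :
    ∃ Y : ℝ × Ω → S, (∀ᵐ ω ∂P, ∀ s : ℝ, X s.toNNReal ω = Y (s, ω)) ∧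
      ∀ Φ : S → ℝ, (∀ c, ‖Φ c‖ₑ ≤ ρ c) →
        (∀ t, Integrable (fun x => Φ (Y x)) ((volume.restrict (Ioc 0 t)).prod P)) ∧
        (∀ t, 0 ≤ t → Integrable (fun ω => Φ (Y (t, ω))) P) ∧
        ∀ t, 0 ≤ t →
          ∫ ω, Φ (Y (t, ω)) ∂P = Φ a + ∫ s in (0 : ℝ)..t, ∫ ω, L Φ (Y (s, ω)) ∂P := by
  have hC : (0 : ℝ) ≤ ((K * (2 * D + D ^ 2) : ℝ≥0) : ℝ) := NNReal.coe_nonneg _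
  have hW := hL.lyapunov_sq hρ hK hD
  have hWf : ∀ c, ρ c ^ 2 ≠ ∞ := fun c => ENNReal.pow_ne_top (hρf c)
  have hle : ∀ c, ρ c ≤ ρ c ^ 2 := fun c => le_self_pow₀ (hρ c) two_ne_zero
  obtain ⟨Y, hY⟩ := hX.exists_regularVersion hL.isRateOperator (W := fun c => ρ c ^ 2) hC (hWf a)
    hW (K := K) ENNReal.coe_ne_top fun c => (hL.exitRate_le hK c).trans (by gcongr; exact hle c)
  refine ⟨Y, hY.eq_version, fun Φ hΦ => ?_⟩
  -- One constant for three bounds relative to ρ²: 1 for Φ, K for the loss, K(1 + D) for the gain.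
  have hK' : (1 + K * (1 + D) : ℝ≥0∞) ≠ ∞ := by finiteness
  have hΦ' : ∀ c, ‖Φ c‖ₑ ≤ (1 + K * (1 + D) : ℝ≥0∞) * ρ c ^ 2 := fun c =>
    calc ‖Φ c‖ₑ ≤ 1 * ρ c ^ 2 := by rw [one_mul]; exact (hΦ c).trans (hle c)
      _ ≤ _ := by gcongr; exact le_self_add
  refine ⟨hY.integrable_prod hC (hWf a) hW hK' hΦ',
    fun t ht => hY.integrable hC (hWf a) hW hK' hΦ' ht,
    fun t ht => hY.dynkin hC (hWf a) hW hWf hK' hΦ' ?_ ?_ ?_ ht⟩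
  · intro c
    calc jumpLoss L (fun c => ‖Φ c‖ₑ) c ≤ K * ρ c * ρ c :=
          mul_le_mul' (hL.exitRate_le hK c) (hΦ c)
      _ = K * (1 + 0) * ρ c ^ 2 := by ring
      _ ≤ (1 + K * (1 + D)) * ρ c ^ 2 := by
          gcongr
          exact le_add_left (by gcongr; exact zero_le)
  · intro c
    rw [hL.jumpGain_eq]
    calc ∑ i ∈ supp c, ENNReal.ofReal (effRate r T i c) * ‖Φ (T i c)‖ₑ
        ≤ ∑ i ∈ supp c, ENNReal.ofReal (effRate r T i c) * (ρ c + D) := by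
          gcongr with i _
          exact (hΦ _).trans (hD i c)
      _ ≤ K * ρ c * (ρ c + D * 1) := by
          rw [← Finset.sum_mul, ← hL.ofReal_exitRate, mul_one]
          gcongr
          exact hL.exitRate_le hK c
      _ ≤ K * ρ c * (ρ c + D * ρ c) := by gcongr; exact hρ c
      _ = K * (1 + D) * ρ c ^ 2 := by ring
      _ ≤ (1 + K * (1 + D)) * ρ c ^ 2 := by gcongr; exact le_add_self
  · intro c
    have hsplit : ∀ x : ℝ, (ENNReal.ofReal x).toReal - (ENNReal.ofReal (-x)).toReal = x := by
      intro x
      rcases le_total 0 x with h | h <;> simp [h, ENNReal.ofReal_of_nonpos]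
    have hgain : ∀ g : S → ℝ, (jumpGain L (fun c => ENNReal.ofReal (g c)) c).toReal =
        ∑ i ∈ supp c, effRate r T i c * (ENNReal.ofReal (g (T i c))).toReal := by
      intro g
      rw [hL.jumpGain_eq, ENNReal.toReal_sum fun i _ => by finiteness]
      refine Finset.sum_congr rfl fun i _ => ?_
      rw [ENNReal.toReal_mul, ENNReal.toReal_ofReal (effRate_nonneg (hL.rate_nonneg i c))]
    simp only [hgain, jumpLoss, ENNReal.toReal_mul, ← mul_sub, hsplit, ← Finset.sum_sub_distrib,
      ENNReal.toReal_ofReal (hL.exitRate_nonneg c)]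
    rw [hL.apply_eq_effRate, hL.exitRate_eq, Finset.sum_mul, ← Finset.sum_sub_distrib]
    exact Finset.sum_congr rfl fun i _ => by ring

end IsMoveOperator

end MoveOperator

/-! ### Coordinates on the configuration space -/

namespace WaveGraph

variable {V H : Type*} [NormedAddCommGroup H]

theorem mem_nbrs (G : WaveGraph V H) {x y : V} : y ∈ G.nbrs x ↔ G.graph.Adj x y := by
  simp [nbrs]

theorem exists_card_nbrs_le (G : WaveGraph V H) : ∃ D : ℕ, ∀ x, (G.nbrs x).card ≤ D := by
  obtain ⟨D, hD⟩ := G.degree_bdd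
  refine ⟨D, fun x => ?_⟩
  have := hD x
  rw [(G.finite_neighborSet x).encard_eq_coe_toFinset_card] at this
  exact_mod_cast this

theorem kEdge_nonneg (G : WaveGraph V H) (e : G.graph.edgeSet) : 0 ≤ G.kEdge e := by
  obtain ⟨e, he⟩ := e
  induction e using Sym2.ind with
  | _ x y => exact G.k_nonneg x y

variable [InnerProductSpace ℝ H]

/-- The value at a node, as a homomorphism. -/
def nodeVal (G : WaveGraph V H) (x : V) : G.config →+ ℝ where
  toFun f := f.1.1 x
  map_zero' := rfl
  map_add' _ _ := rfl

/-- The value at an edge, as a homomorphism. -/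
def edgeVec (G : WaveGraph V H) (e : G.graph.edgeSet) : G.config →+ H where
  toFun f := f.1.2 e
  map_zero' := rfl
  map_add' _ _ := rfl

/-- The component of the value at the edge `⟨x, y⟩` along `e_{xy}`. -/
def edgeVal (G : WaveGraph V H) {x y : V} (h : G.graph.Adj x y) : G.config →+ ℝ :=
  ((innerSL ℝ (G.unit x y)).toLinearMap.toAddMonoidHom).comp (G.edgeVec ⟨s(x, y), h⟩)

theorem edgeVal_apply (G : WaveGraph V H) {x y : V} (h : G.graph.Adj x y) (f : G.config) :
    G.edgeVal h f = inner ℝ (G.unit x y) (f.1.2 ⟨s(x, y), h⟩) := rfl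

theorem inner_unit_self (G : WaveGraph V H) {x y : V} (h : x ≠ y) :
    inner ℝ (G.unit x y) (G.unit x y) = (1 : ℝ) := by
  rw [real_inner_self_eq_norm_sq, G.norm_unit h, one_pow]

theorem eq_edgeVal_smul (G : WaveGraph V H) {x y : V} (h : G.graph.Adj x y) (f : G.config) :
    f.1.2 ⟨s(x, y), h⟩ = G.edgeVal h f • G.unit x y := by
  obtain ⟨n, hn⟩ := G.exists_int_smul_unit f.2.1 h (f.2.2.2.2.2 _)
  rw [edgeVal_apply, hn, inner_smul_right, G.inner_unit_self h.ne, mul_one]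

theorem norm_eq_abs_edgeVal (G : WaveGraph V H) {x y : V} (h : G.graph.Adj x y) (f : G.config) :
    ‖f.1.2 ⟨s(x, y), h⟩‖ = |G.edgeVal h f| := by
  rw [G.eq_edgeVal_smul h f, norm_smul, G.norm_unit h.ne, mul_one, Real.norm_eq_abs]

theorem exists_int_edgeVal (G : WaveGraph V H) {x y : V} (h : G.graph.Adj x y) (f : G.config) :
    ∃ n : ℤ, G.edgeVal h f = n :=
  exists_int_of_abs (by rw [← G.norm_eq_abs_edgeVal]; exact f.2.2.2.2.2 _)

/-- After an orientation of each edge is chosen, a configuration is determined by finitely supported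
integer coordinates; the floor only turns integer-valued reals into integers. -/
instance countable_config [Countable V] (G : WaveGraph V H) : Countable G.config := by
  have hor : ∀ e : G.graph.edgeSet, ∃ x y, ∃ h : G.graph.Adj x y, e = ⟨s(x, y), h⟩ := by
    rintro ⟨e, he⟩
    induction e using Sym2.ind with
    | _ x y => exact ⟨x, y, he, rfl⟩
  choose x y h he using hor
  have hV : ∀ f : G.config, (Function.support fun z => ⌊f.1.1 z⌋).Finite := fun f =>
    f.2.2.1.subset fun z hz h0 => hz (by simp [h0])
  have hE : ∀ f : G.config, (Function.support fun e => ⌊G.edgeVal (h e) f⌋).Finite := fun f =>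
    f.2.2.2.1.subset fun e hz h0 => hz (by simp [edgeVal_apply, ← he, h0])
  let F : G.config → (V →₀ ℤ) × (G.graph.edgeSet →₀ ℤ) := fun f =>
    (Finsupp.ofSupportFinite _ (hV f), Finsupp.ofSupportFinite _ (hE f))
  have hedge : Countable G.graph.edgeSet := by
    have : Countable (Sym2 V) := (Sym2.mk_surjective (α := V)).countable
    infer_instance
  have hF : Function.Injective F := by
    intro f g hfg
    have h1 : ∀ z, ⌊f.1.1 z⌋ = ⌊g.1.1 z⌋ := fun z => DFunLike.congr_fun (congrArg Prod.fst hfg) z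
    have h2 : ∀ e, ⌊G.edgeVal (h e) f⌋ = ⌊G.edgeVal (h e) g⌋ := fun e =>
      DFunLike.congr_fun (congrArg Prod.snd hfg) e
    refine Subtype.ext (Prod.ext (funext fun z => ?_) (funext fun e => ?_))
    · obtain ⟨m, hm⟩ := exists_int_of_abs (f.2.2.2.2.1 z)
      obtain ⟨n, hn⟩ := exists_int_of_abs (g.2.2.2.2.1 z)
      have := h1 z
      rw [hm, hn, Int.floor_intCast, Int.floor_intCast] at this
      rw [hm, hn, this]
    · obtain ⟨m, hm⟩ := G.exists_int_edgeVal (h e) f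
      obtain ⟨n, hn⟩ := G.exists_int_edgeVal (h e) g
      have := h2 e
      rw [hm, hn, Int.floor_intCast, Int.floor_intCast] at this
      rw [he e, G.eq_edgeVal_smul, G.eq_edgeVal_smul, hm, hn, this]
  exact hF.countable

/-! ### The size of a configuration -/

/-- The `ℓ¹` norm of a configuration. -/
def mass (G : WaveGraph V H) (f : G.config) : ℝ≥0∞ :=
  ∑' x, ‖G.nodeVal x f‖ₑ + ∑' e, ‖G.edgeVec e f‖ₑ

theorem mass_ne_top (G : WaveGraph V H) (f : G.config) : G.mass f ≠ ∞ := by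
  have h1 : ∀ x ∉ f.2.2.1.toFinset, ‖G.nodeVal x f‖ₑ = 0 := by
    intro x hx
    simpa [nodeVal] using hx
  have h2 : ∀ e ∉ f.2.2.2.1.toFinset, ‖G.edgeVec e f‖ₑ = 0 := by
    intro x hx
    simpa [edgeVec] using hx
  rw [mass, tsum_eq_sum h1, tsum_eq_sum h2]
  exact ENNReal.add_ne_top.2 ⟨ENNReal.sum_ne_top.2 fun _ _ => enorm_ne_top,
    ENNReal.sum_ne_top.2 fun _ _ => enorm_ne_top⟩

theorem mass_zero (G : WaveGraph V H) : G.mass 0 = 0 := by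
  simp [mass]

theorem mass_neg (G : WaveGraph V H) (f : G.config) : G.mass (-f) = G.mass f := by
  simp [mass]

theorem mass_add_le (G : WaveGraph V H) (f g : G.config) :
    G.mass (f + g) ≤ G.mass f + G.mass g := by
  simp only [mass, map_add]
  calc _ ≤ ∑' x, (‖G.nodeVal x f‖ₑ + ‖G.nodeVal x g‖ₑ) +
        ∑' e, (‖G.edgeVec e f‖ₑ + ‖G.edgeVec e g‖ₑ) := by
        gcongr <;> exact enorm_add_le _ _
    _ = _ := by rw [ENNReal.tsum_add, ENNReal.tsum_add]; ring

theorem mass_sum_le (G : WaveGraph V H) {ι : Type*} (s : Finset ι) (g : ι → G.config) :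
    G.mass (∑ i ∈ s, g i) ≤ ∑ i ∈ s, G.mass (g i) :=
  Finset.le_sum_of_subadditive _ G.mass_zero.le G.mass_add_le s g

theorem mass_sign_smul_le (G : WaveGraph V H) (σ : SignType) (f : G.config) :
    G.mass ((σ : ℤ) • f) ≤ G.mass f := by
  cases σ <;> simp [mass_zero, mass_neg]

theorem mass_deltaEdge_le (G : WaveGraph V H) (x y : V) : G.mass (G.deltaEdge x y) ≤ 1 := by
  classical
  have h1 : ∀ z, ‖G.nodeVal z (G.deltaEdge x y)‖ₑ = 0 := fun z => by
    simp [nodeVal, deltaEdge]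
  have h2 : ∀ e, ‖G.edgeVec e (G.deltaEdge x y)‖ₑ = if e.1 = s(x, y) then ‖G.unit x y‖ₑ else 0 := by
    intro e
    simp only [edgeVec, deltaEdge, AddMonoidHom.coe_mk, ZeroHom.coe_mk]
    split_ifs <;> simp
  rw [mass]
  simp only [h1, h2, tsum_zero, zero_add]
  by_cases h : G.graph.Adj x y
  · rw [tsum_eq_single ⟨s(x, y), h⟩ fun e he => if_neg fun h' => he (Subtype.ext h'), if_pos rfl,
      ← ofReal_norm, G.norm_unit h.ne, ENNReal.ofReal_one]
  · have h3 : ∀ e : G.graph.edgeSet, e.1 ≠ s(x, y) := fun e he =>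
      h (by have := e.2; rwa [he] at this)
    simp [h3]

theorem mass_deltaHat_le (G : WaveGraph V H) (V₀ : Set V) (x : V) :
    G.mass (G.deltaHat V₀ x) ≤ 1 := by
  classical
  have h1 : ∀ z, z ≠ x → ‖G.nodeVal z (G.deltaHat V₀ x)‖ₑ = 0 := fun z hz => by
    simp [nodeVal, deltaHat, hz]
  have h2 : ∀ e, ‖G.edgeVec e (G.deltaHat V₀ x)‖ₑ = 0 := fun e => by
    simp [edgeVec, deltaHat]
  rw [mass, tsum_eq_single x h1]
  simp only [h2, tsum_zero, add_zero]
  simp only [nodeVal, deltaHat, AddMonoidHom.coe_mk, ZeroHom.coe_mk]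
  split_ifs <;> simp

theorem mass_nodeMove_le (G : WaveGraph V H) (f : G.config) (x : V) :
    G.mass (G.nodeMove f x) ≤ G.mass f + (G.nbrs x).card := by
  refine (G.mass_add_le _ _).trans ?_
  gcongr
  refine (G.mass_sign_smul_le _ _).trans ((G.mass_sum_le _ _).trans ?_)
  refine (Finset.sum_le_sum fun y _ => G.mass_deltaEdge_le y x).trans ?_
  simp

theorem edgeMove_mk (G : WaveGraph V H) (V₀ : Set V) (f : G.config) {x y : V}
    (h : G.graph.Adj x y) : G.edgeMove V₀ f ⟨s(x, y), h⟩ =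
      f + (SignType.sign (G.edgeVal h f) : ℤ) • (G.deltaHat V₀ x - G.deltaHat V₀ y) := by
  rw [edgeVal_apply, real_inner_comm]
  rfl

theorem mass_edgeMove_le (G : WaveGraph V H) (V₀ : Set V) (f : G.config) (e : G.graph.edgeSet) :
    G.mass (G.edgeMove V₀ f e) ≤ G.mass f + 2 := by
  obtain ⟨e, he⟩ := e
  induction e using Sym2.ind with
  | _ x y =>
    rw [G.edgeMove_mk V₀ f he]
    refine (G.mass_add_le _ _).trans ?_
    gcongr
    refine (G.mass_sign_smul_le _ _).trans ?_
    rw [sub_eq_add_neg]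
    refine (G.mass_add_le _ _).trans ?_
    rw [mass_neg, ← one_add_one_eq_two]
    exact add_le_add (G.mass_deltaHat_le V₀ x) (G.mass_deltaHat_le V₀ y)

/-! ### The moves of the particle system -/

/-- The rates of the moves, which are indexed by the nodes and the edges. -/
def moveRate (G : WaveGraph V H) (i : V ⊕ G.graph.edgeSet) (f : G.config) : ℝ :=
  Sum.elim (fun x => |f.1.1 x| / G.m x) (fun e => G.kEdge e * ‖f.1.2 e‖) i

/-- The moves, which are indexed by the nodes and the edges. -/
def move (G : WaveGraph V H) (V₀ : Set V) (i : V ⊕ G.graph.edgeSet) (f : G.config) : G.config :=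
  Sum.elim (G.nodeMove f) (G.edgeMove V₀ f) i

/-- The moves that may be possible in a given configuration. -/
def moveSupport (G : WaveGraph V H) (f : G.config) : Finset (V ⊕ G.graph.edgeSet) :=
  f.2.2.1.toFinset.disjSum f.2.2.2.1.toFinset

theorem isMoveOperator_generator (G : WaveGraph V H) (V₀ : Set V) :
    IsMoveOperator (G.generator V₀) G.moveRate (G.move V₀) G.moveSupport where
  rate_nonneg i f := by
    rcases i with x | e
    · exact div_nonneg (abs_nonneg _) (G.m_pos x).le
    · exact mul_nonneg (G.kEdge_nonneg e) (norm_nonneg _)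
  apply_eq Φ f := by
    rw [moveSupport, Finset.sum_disjSum, generator,
      tsum_eq_sum (s := f.2.2.1.toFinset) fun x hx => ?_,
      tsum_eq_sum (s := f.2.2.2.1.toFinset) fun e he => ?_]
    · rfl
    · have : f.1.2 e = 0 := by simpa using he
      simp [this]
    · have : f.1.1 x = 0 := by simpa using hx
      simp [this]

theorem exists_rate_bound (G : WaveGraph V H) : ∃ K : ℝ≥0, ∀ f : G.config,
    ∑ i ∈ G.moveSupport f, ENNReal.ofReal (G.moveRate i f) ≤ K * (1 + G.mass f) := by
  obtain ⟨M, hM⟩ := G.inv_m_bdd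
  obtain ⟨B, hB⟩ := G.k_bdd
  -- Node rates are controlled by the bound on the inverse masses, edge rates by the bound on the
  -- weights.
  refine ⟨M.toNNReal + B.toNNReal, fun f => ?_⟩
  rw [moveSupport, Finset.sum_disjSum]
  have h1 : ∀ x, ENNReal.ofReal (G.moveRate (Sum.inl x) f) ≤
      M.toNNReal * ‖G.nodeVal x f‖ₑ := by
    intro x
    have : G.moveRate (Sum.inl x) f = (G.m x)⁻¹ * |f.1.1 x| := div_eq_inv_mul _ _
    rw [this, ENNReal.ofReal_mul (inv_nonneg.2 (G.m_pos x).le), ← Real.enorm_eq_ofReal_abs]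
    exact mul_le_mul' (ENNReal.ofReal_le_ofReal (hM x)) le_rfl
  have h2 : ∀ e, ENNReal.ofReal (G.moveRate (Sum.inr e) f) ≤
      B.toNNReal * ‖G.edgeVec e f‖ₑ := by
    intro e
    have : G.moveRate (Sum.inr e) f = G.kEdge e * ‖f.1.2 e‖ := rfl
    rw [this, ENNReal.ofReal_mul (G.kEdge_nonneg e), ofReal_norm]
    refine mul_le_mul' (ENNReal.ofReal_le_ofReal ?_) le_rfl
    obtain ⟨e, he⟩ := e
    induction e using Sym2.ind with
    | _ x y => exact hB x y he
  calc _ ≤ ∑ x ∈ f.2.2.1.toFinset, M.toNNReal * ‖G.nodeVal x f‖ₑ +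
        ∑ e ∈ f.2.2.2.1.toFinset, B.toNNReal * ‖G.edgeVec e f‖ₑ :=
        add_le_add (Finset.sum_le_sum fun x _ => h1 x) (Finset.sum_le_sum fun e _ => h2 e)
    _ ≤ ∑' x, M.toNNReal * ‖G.nodeVal x f‖ₑ + ∑' e, B.toNNReal * ‖G.edgeVec e f‖ₑ :=
        add_le_add (ENNReal.sum_le_tsum _) (ENNReal.sum_le_tsum _)
    _ = M.toNNReal * ∑' x, ‖G.nodeVal x f‖ₑ + B.toNNReal * ∑' e, ‖G.edgeVec e f‖ₑ := by
        rw [ENNReal.tsum_mul_left, ENNReal.tsum_mul_left]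
    _ ≤ M.toNNReal * (1 + G.mass f) + B.toNNReal * (1 + G.mass f) := by
        gcongr
        · exact le_add_left le_self_add
        · exact le_add_left le_add_self
    _ = _ := by push_cast; ring

theorem exists_step_bound (G : WaveGraph V H) (V₀ : Set V) : ∃ D : ℝ≥0, ∀ i (f : G.config),
    1 + G.mass (G.move V₀ i f) ≤ 1 + G.mass f + D := by
  obtain ⟨D, hD⟩ := G.exists_card_nbrs_le
  -- A node move adds at most one unit on each incident edge, an edge move at most one unit at each
  -- of its two ends.
  refine ⟨D + 2, fun i f => ?_⟩
  rw [add_assoc]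
  gcongr
  rcases i with x | e
  · refine (G.mass_nodeMove_le f x).trans ?_
    gcongr
    push_cast
    exact le_add_right (by exact_mod_cast hD x)
  · refine (G.mass_edgeMove_le V₀ f e).trans ?_
    gcongr
    push_cast
    exact le_add_self

theorem enorm_nodeVal_le (G : WaveGraph V H) (x : V) (f : G.config) :
    ‖G.nodeVal x f‖ₑ ≤ 1 + G.mass f :=
  (ENNReal.le_tsum x).trans (le_add_left le_self_add)

theorem enorm_edgeVal_le (G : WaveGraph V H) {x y : V} (h : G.graph.Adj x y) (f : G.config) :
    ‖G.edgeVal h f‖ₑ ≤ 1 + G.mass f := by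
  rw [Real.enorm_eq_ofReal_abs, ← G.norm_eq_abs_edgeVal, ofReal_norm]
  exact (ENNReal.le_tsum (f := fun e => ‖G.edgeVec e f‖ₑ) _).trans (le_add_left le_add_self)

/-! ### The generator on linear functionals -/

/-- Rate times signed jump is linear in the configuration; this is why the mean values obey a closed
linear system. -/
theorem abs_mul_sign_intCast (v : ℝ) : |v| * ((SignType.sign v : ℤ) : ℝ) = v := by
  rw [SignType.intCast_cast, mul_comm, sign_mul_abs]

theorem nodeVal_deltaEdge (G : WaveGraph V H) (x y z : V) :
    G.nodeVal z (G.deltaEdge x y) = 0 := rfl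

theorem edgeVal_deltaHat (G : WaveGraph V H) (V₀ : Set V) {x y : V} (h : G.graph.Adj x y) (z : V) :
    G.edgeVal h (G.deltaHat V₀ z) = 0 := by
  rw [edgeVal_apply]
  exact inner_zero_right _

open Classical in
theorem nodeVal_deltaHat (G : WaveGraph V H) (V₀ : Set V) (x z : V) :
    G.nodeVal z (G.deltaHat V₀ x) = if z = x ∧ x ∈ V₀ then 1 else 0 := rfl

open Classical in
theorem edgeVal_deltaEdge (G : WaveGraph V H) {x y : V} (h : G.graph.Adj x y) (w z : V) :
    G.edgeVal h (G.deltaEdge w z) =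
      if w = x ∧ z = y then 1 else if w = y ∧ z = x then -1 else 0 := by
  have h0 : (G.deltaEdge w z).1.2 ⟨s(x, y), h⟩ =
    if s(x, y) = s(w, z) then G.unit w z else 0 := rfl
  rw [edgeVal_apply, h0]
  by_cases h1 : w = x ∧ z = y
  · obtain ⟨rfl, rfl⟩ := h1
    rw [if_pos rfl, if_pos ⟨rfl, rfl⟩, G.inner_unit_self h.ne]
  · by_cases h2 : w = y ∧ z = x
    · obtain ⟨rfl, rfl⟩ := h2
      rw [if_neg h1, if_pos (And.intro rfl rfl), if_pos Sym2.eq_swap, G.unit_swap z w, inner_neg_right,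
        G.inner_unit_self h.ne]
    · rw [if_neg h1, if_neg h2, if_neg, inner_zero_right]
      rw [Sym2.eq_iff]
      rintro (⟨rfl, rfl⟩ | ⟨rfl, rfl⟩)
      exacts [h1 ⟨rfl, rfl⟩, h2 ⟨rfl, rfl⟩]

/-- Only node moves change edges. A node adds unit vectors pointing towards itself, so y contributes
with sign + along e_{xy} and x with sign -. -/
theorem generator_edgeVal (G : WaveGraph V H) (V₀ : Set V) {x y : V} (h : G.graph.Adj x y)
    (f : G.config) : G.generator V₀ (G.edgeVal h) f =
      G.nodeVal y f / G.m y - G.nodeVal x f / G.m x := by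
  classical
  have hedge : ∀ e : G.graph.edgeSet, G.edgeVal h (G.edgeMove V₀ f e) - G.edgeVal h f = 0 := by
    rintro ⟨e, he⟩
    induction e using Sym2.ind with
    | _ a b => simp [G.edgeMove_mk V₀ f he, edgeVal_deltaHat]
  have hsum : ∀ z, ∑ w ∈ G.nbrs z, G.edgeVal h (G.deltaEdge w z) =
      if z = y then 1 else if z = x then -1 else 0 := by
    intro z
    by_cases hy : z = y
    · subst hy
      rw [Finset.sum_eq_single_of_mem x (G.mem_nbrs.2 h.symm)]
      · simp [edgeVal_deltaEdge]
      · intro w _ hw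
        simp [edgeVal_deltaEdge, hw, h.ne.symm]
    · by_cases hx : z = x
      · subst hx
        rw [Finset.sum_eq_single_of_mem y (G.mem_nbrs.2 h)]
        · simp [edgeVal_deltaEdge, h.ne]
        · intro w _ hw
          simp [edgeVal_deltaEdge, hw, h.ne]
      · simp [edgeVal_deltaEdge, hx, hy]
  have hnode : ∀ z, |f.1.1 z| / G.m z * (G.edgeVal h (G.nodeMove f z) - G.edgeVal h f) =
      G.nodeVal z f / G.m z * if z = y then 1 else if z = x then -1 else 0 := by
    intro z
    rw [nodeMove, map_add, map_zsmul, map_sum, hsum, add_sub_cancel_left, zsmul_eq_mul, ← mul_assoc,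
      div_mul_eq_mul_div, abs_mul_sign_intCast]
    rfl
  rw [generator]
  simp only [hedge, hnode, mul_zero, tsum_zero, add_zero]
  rw [tsum_eq_sum (s := {x, y}), Finset.sum_pair h.ne]
  · rw [if_neg h.ne, if_pos rfl, if_pos rfl]; ring
  · intro z hz
    simp only [Finset.mem_insert, Finset.mem_singleton, not_or] at hz
    simp [hz.1, hz.2]

theorem generator_nodeVal (G : WaveGraph V H) (V₀ : Set V) {x : V} (hx : x ∈ V₀) (f : G.config) :
    G.generator V₀ (G.nodeVal x) f =
      ∑ y ∈ (G.nbrs x).attach, G.k x y * G.edgeVal (G.mem_nbrs.1 y.2) f := by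
  classical
  have hnode : ∀ z, G.nodeVal x (G.nodeMove f z) - G.nodeVal x f = 0 := by
    intro z
    simp [nodeMove, nodeVal_deltaEdge]
  rw [generator]
  simp only [hnode, mul_zero, tsum_zero, zero_add]
  -- Only edges at x can change the value there. Indexing them by the other end orients each one
  -- away from x, so x enters every move with coefficient +1.
  let g : G.nbrs x → G.graph.edgeSet := fun y => ⟨s(x, y), G.mem_nbrs.1 y.2⟩
  have hg : Function.Injective g := by
    intro y y' hyy
    have : s(x, (y : V)) = s(x, (y' : V)) := congrArg Subtype.val hyy
    exact Subtype.ext (Sym2.congr_right.1 this)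
  rw [← hg.tsum_eq, tsum_fintype, Finset.univ_eq_attach]
  · refine Finset.sum_congr rfl fun y _ => ?_
    have hxy : G.graph.Adj x y := G.mem_nbrs.1 y.2
    change G.k x y * ‖f.1.2 ⟨s(x, (y : V)), hxy⟩‖ *
      (G.nodeVal x (G.edgeMove V₀ f ⟨s(x, (y : V)), hxy⟩) - G.nodeVal x f) = _
    rw [G.edgeMove_mk V₀ f hxy, map_add, map_zsmul, map_sub, add_sub_cancel_left,
      G.norm_eq_abs_edgeVal, nodeVal_deltaHat, nodeVal_deltaHat, if_pos ⟨rfl, hx⟩,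
      if_neg fun h => hxy.ne h.1, sub_zero, zsmul_eq_mul, mul_one, mul_assoc,
      abs_mul_sign_intCast]
  · rintro ⟨e, he⟩ hne
    induction e using Sym2.ind with
    | _ a b =>
      have hab : G.graph.Adj a b := he
      by_cases ha : x = a
      · subst ha
        exact ⟨⟨b, G.mem_nbrs.2 hab⟩, rfl⟩
      · by_cases hb : x = b
        · subst hb
          exact ⟨⟨a, G.mem_nbrs.2 hab.symm⟩, Subtype.ext Sym2.eq_swap⟩
        · refine absurd ?_ hne
          simp [G.edgeMove_mk V₀ f hab, nodeVal_deltaHat, ha, hb]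

theorem generator_nodeVal_boundary (G : WaveGraph V H) (V₀ : Set V) {x : V} (hx : x ∉ V₀)
    (f : G.config) : G.generator V₀ (G.nodeVal x) f = 0 := by
  classical
  have hnode : ∀ z, G.nodeVal x (G.nodeMove f z) - G.nodeVal x f = 0 := by
    intro z
    simp [nodeMove, nodeVal_deltaEdge]
  have hhat : ∀ z, G.nodeVal x (G.deltaHat V₀ z) = 0 := by
    intro z
    rw [nodeVal_deltaHat, if_neg]
    rintro ⟨rfl, h⟩
    exact hx h
  have hedge : ∀ e : G.graph.edgeSet, G.nodeVal x (G.edgeMove V₀ f e) - G.nodeVal x f = 0 := by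
    rintro ⟨e, he⟩
    induction e using Sym2.ind with
    | _ a b => simp [G.edgeMove_mk V₀ f he, hhat]
  simp [generator, hnode, hedge]

end WaveGraph

/-! ### Integral equations on the half line -/

theorem continuousOn_of_eq_integral {F g : ℝ → ℝ} {c : ℝ}
    (hg : ∀ t, 0 ≤ t → IntervalIntegrable g volume 0 t)
    (hF : ∀ t, 0 ≤ t → F t = c + ∫ s in (0 : ℝ)..t, g s) : ContinuousOn F (Ici 0) := by
  have h1 : ∀ b, 0 ≤ b → ContinuousOn F (Icc 0 b) := by
    intro b hb
    have h2 : ContinuousOn (fun t => c + ∫ s in (0 : ℝ)..t, g s) (Icc 0 b) := by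
      have := intervalIntegral.continuousOn_primitive_interval' (hg b hb) left_mem_uIcc
      rw [uIcc_of_le hb] at this
      exact continuousOn_const.add this
    exact h2.congr fun t ht => hF t ht.1
  intro t ht
  refine ((h1 (t + 1) (by linarith [mem_Ici.1 ht])) t ⟨ht, by linarith⟩).mono_of_mem_nhdsWithin ?_
  filter_upwards [self_mem_nhdsWithin, mem_nhdsWithin_of_mem_nhds (Iio_mem_nhds (lt_add_one t))]
    with s hs hs' using ⟨hs, le_of_lt hs'⟩

theorem hasDerivWithinAt_of_eq_integral {F g : ℝ → ℝ} {c : ℝ} (hg : ContinuousOn g (Ici 0))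
    (hF : ∀ t, 0 ≤ t → F t = c + ∫ s in (0 : ℝ)..t, g s) {t : ℝ} (ht : 0 ≤ t) :
    HasDerivWithinAt F (g t) (Ici 0) t := by
  -- Extending the integrand by its value at 0 to negative times allows the two-sided fundamental
  -- theorem, which then restricts to a one-sided derivative at 0.
  have hcont : Continuous fun s => g (max 0 s) :=
    hg.comp_continuous (by fun_prop) fun s => le_max_left 0 s
  have h1 : HasDerivAt (fun t => c + ∫ s in (0 : ℝ)..t, g (max 0 s)) (g t) t := by
    have := (intervalIntegral.integral_hasDerivAt_right (hcont.intervalIntegrable 0 t)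
      hcont.stronglyMeasurable.stronglyMeasurableAtFilter hcont.continuousAt).const_add c
    rwa [max_eq_right ht] at this
  refine h1.hasDerivWithinAt.congr_of_mem (fun s hs => ?_) ht
  rw [hF s hs]
  congr 1
  refine intervalIntegral.integral_congr fun r hr => ?_
  rw [uIcc_of_le hs] at hr
  simp only [max_eq_right hr.1]

end

/-! ### The Feynman–Kac-type formula -/

theorem mainTheorem1
    {V H Ω : Type*} [Countable V]
    [NormedAddCommGroup H] [InnerProductSpace ℝ H] [CompleteSpace H]
    (G : WaveGraph V H) (V₀ V₁ : Set V) (hdisj : Disjoint V₀ V₁) (hunion : V₀ ∪ V₁ = Set.univ)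
    (φ ψ : V → ℝ) (hψ : ∀ x ∈ V₁, ψ x = 0)
    (hf : G.initialField φ ψ ∈ G.config)
    [MeasurableSpace Ω] (P : Measure Ω) [IsProbabilityMeasure P]
    (X : ℝ≥0 → Ω → G.config) (hX : G.IsIPS V₀ ⟨G.initialField φ ψ, hf⟩ P X) :
    (∀ (x : V) (t : ℝ), 0 ≤ t →
      (∀ᵐ ω ∂P, IntervalIntegrable (fun s : ℝ => (X s.toNNReal ω).1.1 x) volume 0 t) ∧
      Integrable (fun ω => ∫ s in (0 : ℝ)..t, (X s.toNNReal ω).1.1 x) P) ∧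
    G.SolvesDirichlet V₀ V₁ φ ψ
      (fun x t => φ x + 1 / G.m x * ∫ ω, (∫ s in (0 : ℝ)..t, (X s.toNNReal ω).1.1 x) ∂P) := by
  obtain ⟨K, hK⟩ := G.exists_rate_bound
  obtain ⟨D, hD⟩ := G.exists_step_bound V₀
  have : MeasurableSingletonClass G.config := ⟨fun _ => trivial⟩
  obtain ⟨Y, hXY, hY⟩ := IsMoveOperator.exists_dynkin (ρ := fun f => 1 + G.mass f) hX
    (G.isMoveOperator_generator V₀) (fun _ => le_self_add)
    (fun f => ENNReal.add_ne_top.2 ⟨ENNReal.one_ne_top, G.mass_ne_top f⟩) hK hD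
  have hprod := fun x => (hY (G.nodeVal x) (G.enorm_nodeVal_le x)).1
  set N : V → ℝ → ℝ := fun x t => ∫ ω, G.nodeVal x (Y (t, ω)) ∂P with hN
  -- Fubini for the time integrals of the paths
  have hpath : ∀ x t, 0 ≤ t →
      (∀ᵐ ω ∂P, IntervalIntegrable (fun s : ℝ => (X s.toNNReal ω).1.1 x) volume 0 t) ∧
      Integrable (fun ω => ∫ s in (0 : ℝ)..t, (X s.toNNReal ω).1.1 x) P ∧
      ∫ ω, (∫ s in (0 : ℝ)..t, (X s.toNNReal ω).1.1 x) ∂P = ∫ s in (0 : ℝ)..t, N x s := by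
    intro x t ht
    have heq : (fun ω => ∫ s in (0 : ℝ)..t, (X s.toNNReal ω).1.1 x) =ᵐ[P]
        fun ω => ∫ s in Ioc 0 t, G.nodeVal x (Y (s, ω)) := by
      filter_upwards [hXY] with ω hω
      simp only [hω, intervalIntegral.integral_of_le ht]
      rfl
    refine ⟨?_, (hprod x t).integral_prod_right.congr heq.symm, ?_⟩
    · filter_upwards [hXY, (hprod x t).prod_left_ae] with ω hω hint
      rw [intervalIntegrable_iff_integrableOn_Ioc_of_le ht]
      simp only [hω]
      exact hint
    · rw [integral_congr_ae heq, intervalIntegral.integral_of_le ht,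
        integral_integral_swap (f := fun ω s => G.nodeVal x (Y (s, ω))) (hprod x t).swap]
  refine ⟨fun x t ht => ⟨(hpath x t ht).1, (hpath x t ht).2.1⟩, ?_⟩
  set u : V → ℝ → ℝ := fun x t =>
    φ x + 1 / G.m x * ∫ ω, (∫ s in (0 : ℝ)..t, (X s.toNNReal ω).1.1 x) ∂P with hu
  have hNint : ∀ x t, 0 ≤ t → IntervalIntegrable (N x) volume 0 t := by
    intro x t ht
    rw [intervalIntegrable_iff_integrableOn_Ioc_of_le ht]
    exact (hprod x t).integral_prod_left
  have hu_eq : ∀ x t, 0 ≤ t → u x t = φ x + ∫ s in (0 : ℝ)..t, 1 / G.m x * N x s := by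
    intro x t ht
    rw [intervalIntegral.integral_const_mul, ← (hpath x t ht).2.2]
  have hN_eq : ∀ x t, 0 ≤ t → N x t = G.m x * ψ x +
      ∫ s in (0 : ℝ)..t, ∫ ω, G.generator V₀ (G.nodeVal x) (Y (s, ω)) ∂P := fun x =>
    (hY (G.nodeVal x) (G.enorm_nodeVal_le x)).2.2
  -- The mean edge values are the increments of the solution
  have hE : ∀ x y (h : G.graph.Adj x y) t, 0 ≤ t →
      ∫ ω, G.edgeVal h (Y (t, ω)) ∂P = u y t - u x t := by
    intro x y h t ht
    have h1 := (hY (G.edgeVal h) (G.enorm_edgeVal_le h)).2.2 t ht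
    have h2 : G.edgeVal h ⟨G.initialField φ ψ, hf⟩ = φ y - φ x := by
      rw [G.edgeVal_apply]
      change inner ℝ (G.unit x y) ((φ y - φ x) • G.unit x y) = _
      rw [inner_smul_right, G.inner_unit_self h.ne, mul_one]
    have h3 : ∀ s, 0 ≤ s → ∫ ω, G.generator V₀ (G.edgeVal h) (Y (s, ω)) ∂P =
        1 / G.m y * N y s - 1 / G.m x * N x s := by
      intro s hs
      simp only [G.generator_edgeVal V₀ h]
      rw [integral_sub (((hY _ (G.enorm_nodeVal_le y)).2.1 s hs).div_const _)
        (((hY _ (G.enorm_nodeVal_le x)).2.1 s hs).div_const _), integral_div, integral_div]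
      ring
    have h4 : ∫ s in (0 : ℝ)..t, ∫ ω, G.generator V₀ (G.edgeVal h) (Y (s, ω)) ∂P =
        ∫ s in (0 : ℝ)..t, (1 / G.m y * N y s - 1 / G.m x * N x s) :=
      intervalIntegral.integral_congr fun s hs => h3 s (by rw [uIcc_of_le ht] at hs; exact hs.1)
    rw [h1, h2, h4, intervalIntegral.integral_sub ((hNint y t ht).const_mul _)
      ((hNint x t ht).const_mul _), hu_eq y t ht, hu_eq x t ht]
    ring
  -- Regularity bootstrap: N is only known to be integrable in time, which makes u continuous; then
  -- N on V₀ is the integral of a continuous function, hence differentiable; with N = 0 on V₁, it is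
  -- continuous everywhere and u is C¹.
  have hu_cont : ∀ x, ContinuousOn (u x) (Ici 0) := fun x =>
    continuousOn_of_eq_integral (fun t ht => (hNint x t ht).const_mul _) (hu_eq x)
  have hN_wave : ∀ x ∈ V₀, ∀ t, 0 ≤ t → HasDerivWithinAt (N x)
      (∑ y ∈ G.nbrs x, G.k x y * (u y t - u x t)) (Ici 0) t := by
    intro x hx t ht
    refine hasDerivWithinAt_of_eq_integral (c := G.m x * ψ x)
      (g := fun s => ∑ y ∈ G.nbrs x, G.k x y * (u y s - u x s)) ?_ (fun t ht => ?_) ht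
    · exact continuousOn_finsetSum _ fun y _ =>
        continuousOn_const.mul ((hu_cont y).sub (hu_cont x))
    · rw [hN_eq x t ht]
      congr 1
      refine intervalIntegral.integral_congr fun s hs => ?_
      rw [uIcc_of_le ht] at hs
      simp only [G.generator_nodeVal V₀ hx]
      rw [integral_finsetSum _ fun y _ =>
        ((hY _ (G.enorm_edgeVal_le (G.mem_nbrs.1 y.2))).2.1 s hs.1).const_mul _]
      simp only [integral_const_mul, hE _ _ _ s hs.1]
      exact Finset.sum_attach _ fun y => G.k x y * (u y s - u x s)
  -- On V₁ the initial value m_x ψ(x) is 0 and the generator leaves the coordinate unchanged.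
  have hN_boundary : ∀ x ∈ V₁, ∀ t, 0 ≤ t → N x t = 0 := by
    intro x hx t ht
    have hx0 : x ∉ V₀ := fun h => Set.disjoint_left.1 hdisj h hx
    rw [hN_eq x t ht, hψ x hx]
    simp [G.generator_nodeVal_boundary V₀ hx0]
  have hN_cont : ∀ x, ContinuousOn (N x) (Ici 0) := by
    intro x
    rcases (hunion.symm ▸ mem_univ x : x ∈ V₀ ∪ V₁) with hx | hx
    · exact fun t ht => (hN_wave x hx t ht).continuousWithinAt
    · exact continuousOn_const.congr (hN_boundary x hx)
  have hu_deriv : ∀ x t, 0 ≤ t → HasDerivWithinAt (u x) (1 / G.m x * N x t) (Ici 0) t :=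
    fun x t ht => hasDerivWithinAt_of_eq_integral (continuousOn_const.mul (hN_cont x)) (hu_eq x) ht
  have hm : ∀ x, G.m x ≠ 0 := fun x => (G.m_pos x).ne'
  refine ⟨fun x hx => ⟨fun t => 1 / G.m x * N x t, hu_deriv x, fun t ht =>
    ⟨_, (hN_wave x hx t ht).const_mul _, ?_⟩⟩, fun x => ?_, fun x => ?_, fun x hx t ht => ?_⟩
  · rw [← mul_assoc, mul_one_div_cancel (hm x), one_mul]
    refine hasSum_sum_of_ne_finset_zero fun y hy => ?_
    rw [G.k_eq_zero x y fun h => hy (G.mem_nbrs.2 h), zero_mul]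
  · simp [hu_eq x 0 le_rfl]
  · have h1 := hu_deriv x 0 le_rfl
    rw [hN_eq x 0 le_rfl, intervalIntegral.integral_same, add_zero, ← mul_assoc,
      one_div_mul_cancel (hm x), one_mul] at h1
    exact h1
  · rw [hu_eq x t ht, intervalIntegral.integral_congr (g := fun _ => 0)]
    · simp
    · intro s hs
      rw [uIcc_of_le ht] at hs
      simp [hN_boundary x hx s hs.1]
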